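/- Let $V_0=\{(0,0),(1,0),(0,1),(1,1)\}$ and let $\mathcal V_0=(V_0,E_0)$ be the complete graph on $V_0$. For $n\ge 1$ let the $n$-level Vicsek graph $\mathcal V_n=(V_n,E_n)$ be the union of $\mathcal V_{n-1}$ and its four translates by $(3^{n-1},3^{n-1})$, $(2\cdot 3^{n-1},0)$, $(0,2\cdot 3^{n-1})$ and $(2\cdot 3^{n-1},2\cdot 3^{n-1})$. The infinite Vicsek graph is $\mathcal V=(V,E)=\big(\bigcup_n V_n,\bigcup_n E_n\big)$; put $o=(0,0)$. On $\mathcal V_n$ let $s_n=(3^n,3^n)$ be the sink. A sandpile on $\mathcal V_n$ (respectively on $\mathcal V$) is a function $\sigma$ from $V_n\setminus\{s_n\}$ (respectively from $V$) to $\{0,1,2,\dots\}$; it is stable if $\sigma(v)<\deg(v)$ for all $v$. A vertex $v$ may be toppled legally if $\sigma(v)\ge\deg(v)$: then $v$ loses $\deg(v)$ particles and each of its neighbours gains one (particles sent to the sink are lost). The stabilization of $\sigma$ is the stable sandpile reached from $\sigma$ by finitely many legal topplings. Let $\mathcal R_n$ be the set of recurrent states of the Markov chain on stable sandpiles on $\mathcal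 V_n$ that in each step adds one particle at a uniformly chosen vertex of $V_n\setminus\{s_n\}$ and stabilizes, and let $\mu_n$ be the uniform distribution on $\mathcal R_n$. Then there is exactly one probability measure $\mu$ on $\{0,1,2,\dots\}^{V}$, called the infinite volume limit, such that $$\lim_{k\to\infty}\mu_k\big(\eta|_{V_n\setminus\{s_n\}}=\sigma\big)=\mu\big(\eta|_{V_n\setminus\{s_n\}}=\sigma\big)\qquad\text{for all } n\ge 0 \text{ and } \sigma\in\mathcal R_n .$$ If $\eta$ is sampled from $\mu$, then $$\mu(\eta+\delta_o\text{ stabilizes})=\frac34,\qquad \mu(\eta+\delta_o\text{ explodes})=\frac14 .$$ Here a sandpile on $\mathcal V$ stabilizes if finitely many legal topplings lead to a stable sandpile, and it explodes if for every vertex $v$ and every $N$ there is a finite sequence of legal topplings in which $v$ topples at least $N$ times. -/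

import Mathlib

/-! ### Abelian sandpiles

`G` is a graph on an ambient type `X` and `W : Set X` is the set of vertices that carry particles.
For a finite graph with sink `s`, `W` is the set of all its vertices but `s`; particles that
are sent out of `W` are lost. For an infinite graph without sink, `W` is its whole vertex set. -/

namespace Sandpile

/-- The number of neighbours of `v` in `G` (a sink counts as a neighbour). -/
noncomputable def deg {X : Type*} (G : SimpleGraph X) (v : X) : ℕ :=
  (G.neighborSet v).ncard

open Classical in
/-- The graph Laplacian. -/
noncomputable def laplacian {X : Type*} (G : SimpleGraph X) (x y : X) : ℤ :=
  if x = y then (deg G x : ℤ) else if G.Adj x y then -1 else 0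

/-- A sandpile is stable if every vertex holds fewer particles than its degree. -/
def Stable {X : Type*} (G : SimpleGraph X) {W : Set X} (σ : W → ℕ) : Prop :=
  ∀ v : W, σ v < deg G (v : X)

/-- `τ = T_v σ`, and this toppling at `v` is legal. -/
def LegalToppling {X : Type*} (G : SimpleGraph X) {W : Set X} (v : W) (σ τ : W → ℕ) : Prop :=
  deg G (v : X) ≤ σ v ∧ ∀ w : W, (τ w : ℤ) = (σ w : ℤ) - laplacian G (v : X) (w : X)

/-- `LegalTopplings G l σ τ`: toppling successively at the vertices of the finite list `l`,
each toppling being legal, turns `σ` into `τ`. -/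
inductive LegalTopplings {X : Type*} (G : SimpleGraph X) {W : Set X} :
    List W → (W → ℕ) → (W → ℕ) → Prop
  | nil (σ : W → ℕ) : LegalTopplings G [] σ σ
  | cons {v : W} {l : List W} {σ τ ρ : W → ℕ} :
      LegalToppling G v σ τ → LegalTopplings G l τ ρ → LegalTopplings G (v :: l) σ ρ

/-- `τ` is the stabilization `σ°` of `σ`: it is stable and is reached from `σ` by finitely many
legal topplings. -/
def IsStabilization {X : Type*} (G : SimpleGraph X) {W : Set X} (σ τ : W → ℕ) : Prop :=
  (∃ l : List W, LegalTopplings G l σ τ) ∧ Stable G τ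

/-- `σ` stabilizes: finitely many legal topplings lead to a stable sandpile. -/
def Stabilizes {X : Type*} (G : SimpleGraph X) {W : Set X} (σ : W → ℕ) : Prop :=
  ∃ τ : W → ℕ, IsStabilization G σ τ

open Classical in
/-- `σ` explodes: every vertex topples arbitrarily often in legal toppling sequences. -/
def Explodes {X : Type*} (G : SimpleGraph X) {W : Set X} (σ : W → ℕ) : Prop :=
  ∀ (v : W) (N : ℕ), ∃ (l : List W) (τ : W → ℕ), LegalTopplings G l σ τ ∧ N ≤ l.count v

open Classical in
/-- Adding one particle at `v`. -/
noncomputable def addParticle {X : Type*} {W : Set X} (σ : W → ℕ) (v : W) : W → ℕ :=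
  σ + Pi.single v 1

/-- The transitions of positive probability of the sandpile Markov chain: add a particle at
some vertex (chosen uniformly at random) and stabilize. -/
def Transition {X : Type*} (G : SimpleGraph X) {W : Set X} (σ τ : W → ℕ) : Prop :=
  ∃ v : W, IsStabilization G (addParticle σ v) τ

/-- The recurrent states of the sandpile Markov chain (for finite `W`, so that the chain has a
finite state space): stable sandpiles to which the chain can return from every state that it can
reach from them. -/
def Recurrent {X : Type*} (G : SimpleGraph X) {W : Set X} (σ : W → ℕ) : Prop :=
  Stable G σ ∧ ∀ τ : W → ℕ,
    Relation.ReflTransGen (Transition G) σ τ → Relation.ReflTransGen (Transition G) τ σ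

/-- The restriction of a sandpile to a smaller set of vertices. -/
def restrict {X : Type*} {A B : Set X} (h : A ⊆ B) (η : B → ℕ) : A → ℕ :=
  fun v => η (Set.inclusion h v)

end Sandpile

/-! ### Vicsek graphs -/

namespace Vicsek

/-- Translation by `a`. -/
def shift (a : ℕ × ℕ) : ℕ × ℕ ↪ ℕ × ℕ := addLeftEmbedding a

/-- The vertex set of the `n`-level Vicsek graph. -/
def vertices : ℕ → Set (ℕ × ℕ)
  | 0 => {(0, 0), (1, 0), (0, 1), (1, 1)}
  | n + 1 => vertices n
      ∪ shift (3 ^ n, 3 ^ n) '' vertices n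
      ∪ shift (2 * 3 ^ n, 0) '' vertices n
      ∪ shift (0, 2 * 3 ^ n) '' vertices n
      ∪ shift (2 * 3 ^ n, 2 * 3 ^ n) '' vertices n

/-- The edges of the `n`-level Vicsek graph. -/
def graph : ℕ → SimpleGraph (ℕ × ℕ)
  | 0 => SimpleGraph.fromRel (fun v w => v ∈ vertices 0 ∧ w ∈ vertices 0)
  | n + 1 => graph n
      ⊔ (graph n).map (shift (3 ^ n, 3 ^ n))
      ⊔ (graph n).map (shift (2 * 3 ^ n, 0))
      ⊔ (graph n).map (shift (0, 2 * 3 ^ n))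
      ⊔ (graph n).map (shift (2 * 3 ^ n, 2 * 3 ^ n))

/-- The vertex set of the infinite Vicsek graph. -/
def allVertices : Set (ℕ × ℕ) := ⋃ n, vertices n

/-- The edges of the infinite Vicsek graph. -/
def infiniteGraph : SimpleGraph (ℕ × ℕ) := ⨆ n, graph n

/-- The sink of the `n`-level Vicsek graph is its upper right corner. -/
def sink (n : ℕ) : ℕ × ℕ := (3 ^ n, 3 ^ n)

/-- The vertices of the `n`-level Vicsek graph other than the sink. -/
def sites (n : ℕ) : Set (ℕ × ℕ) := vertices n \ {sink n}

theorem vertices_mono {n k : ℕ} (h : n ≤ k) : vertices n ⊆ vertices k := by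
  induction h with
  | refl => exact subset_rfl
  | step _ ih =>
    intro v hv
    exact Or.inl (Or.inl (Or.inl (Or.inl (ih hv))))

theorem fst_le_of_mem_vertices {n : ℕ} : ∀ {v : ℕ × ℕ}, v ∈ vertices n → v.1 ≤ 3 ^ n := by
  induction n with
  | zero =>
    intro v hv
    rcases hv with rfl | rfl | rfl | rfl <;> simp
  | succ n ih =>
    intro v hv
    rw [pow_succ]
    rcases hv with (((hv | ⟨w, hw, rfl⟩) | ⟨w, hw, rfl⟩) | ⟨w, hw, rfl⟩) | ⟨w, hw, rfl⟩
    · have := ih hv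
      omega
    all_goals
      have := ih hw
      simp only [shift, addLeftEmbedding_apply, Prod.fst_add]
      omega

theorem sites_subset_sites {n k : ℕ} (h : n ≤ k) : sites n ⊆ sites k := by
  rintro v ⟨hv, hs⟩
  refine ⟨vertices_mono h hv, ?_⟩
  rcases h.eq_or_lt with rfl | h
  · exact hs
  · rintro rfl
    have h1 : (3 : ℕ) ^ k ≤ 3 ^ n := fst_le_of_mem_vertices hv
    have h2 : (3 : ℕ) ^ n < 3 ^ k := Nat.pow_lt_pow_right (by norm_num) h
    omega

theorem sites_subset_allVertices (n : ℕ) : sites n ⊆ allVertices :=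
  fun _ hv => Set.mem_iUnion.2 ⟨n, hv.1⟩

theorem zero_mem_allVertices : ((0, 0) : ℕ × ℕ) ∈ allVertices :=
  Set.mem_iUnion.2 ⟨0, Or.inl rfl⟩

/-- The origin `o = (0, 0)` of the infinite Vicsek graph. -/
def origin : allVertices := ⟨(0, 0), zero_mem_allVertices⟩

/-- The set of recurrent sandpiles on the `n`-level Vicsek graph with its sink. -/
def recurrentSet (n : ℕ) : Set (sites n → ℕ) :=
  {σ | Sandpile.Recurrent (graph n) σ}

/-- The uniform distribution on the (finite) set of recurrent sandpiles of level `n`. -/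
noncomputable def uniformMeasure (n : ℕ) : MeasureTheory.Measure (sites n → ℕ) :=
  ProbabilityTheory.uniformOn (recurrentSet n)

/-- `μ` is the infinite volume limit: a probability measure on sandpiles on the infinite Vicsek
graph to which the uniform distributions on the recurrent sandpiles of level `k` converge weakly
as `k → ∞`. -/
structure IsInfiniteVolumeLimit (μ : MeasureTheory.Measure (allVertices → ℕ)) : Prop where
  isProbabilityMeasure : MeasureTheory.IsProbabilityMeasure μ
  weakLimit : ∀ ε : ℝ, 0 < ε → ∀ n : ℕ, ∀ σ ∈ recurrentSet n, ∃ N : ℕ, ∀ k : ℕ,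
    ∀ hn : n ≤ k, N ≤ k →
      |(uniformMeasure k).real {η | Sandpile.restrict (sites_subset_sites hn) η = σ}
        - μ.real {η | Sandpile.restrict (sites_subset_allVertices n) η = σ}| < ε

end Vicsek

/-! The Vicsek graph is a tree of copies of `K₄`, the cells, glued at vertices. Each cell has a
root, the corner through which paths leave towards infinity (or towards the sink), and every vertex
other than the sink is a non-root corner, a site, of exactly one cell.

Recurrent sandpiles are the stable ones without forbidden subconfigurations
(`recurrent_iff_allowed`). On a tree of cells this condition decouples: after subtracting from each
vertex the number of its neighbours behind it, one is left with an arbitrary choice, in every cell,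
of one of the 16 recurrent states of `K₄` with the root as sink (`CellStructure.recurrent_iff`).
Hence the uniform recurrent sandpile of level `n` is a family of independent uniform cell states.
These laws are consistent in `n`, and the infinite volume limit is the image of a product measure.

Toppling a site once together with everything behind it acts on its cell like one toppling in `K₄`
and sends one particle to the root (`exists_legalTopplings_cellTopple`). A particle added at `o`
therefore travels along the diagonal cells: if `k` particles enter such a cell, `cellOut k` of its
state leave through the root and enter the next. With independent uniform states this number is a
Markov chain on `{0,1,2,3,4}` started at 1. It is a martingale and is absorbed at 0 or 4, so it ends
at 4 with probability 1/4. At 0 the sandpile has become stable. At 4 the particles pass through all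
further cells without changing them, and all that lies behind an entered site topples each time, so
the sandpile explodes. -/

namespace Sandpile

variable {X : Type*} {G : SimpleGraph X} {W : Set X}

/-! ### Abelian property of legal topplings -/

section Abelian

theorem laplacian_self (v : X) : laplacian G v v = deg G v := by simp [laplacian]

theorem laplacian_nonpos {v w : X} (h : v ≠ w) : laplacian G v w ≤ 0 := by
  unfold laplacian
  rw [if_neg h]
  split_ifs <;> simp

theorem LegalToppling.unique {v : W} {σ τ ρ : W → ℕ} (h : LegalToppling G v σ τ)
    (h' : LegalToppling G v σ ρ) : τ = ρ := by
  funext w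
  have h1 := h.2 w
  have h2 := h'.2 w
  omega

theorem LegalToppling.le_of_ne {v w : W} {σ τ : W → ℕ} (h : LegalToppling G v σ τ)
    (hw : v ≠ w) : σ w ≤ τ w := by
  have h1 := h.2 w
  have h2 := laplacian_nonpos (G := G) (fun h => hw (Subtype.ext h) : (v : X) ≠ w)
  omega

theorem exists_legalToppling {v : W} {σ : W → ℕ} (h : deg G (v : X) ≤ σ v) :
    ∃ τ, LegalToppling G v σ τ := by
  refine ⟨fun w => ((σ w : ℤ) - laplacian G (v : X) (w : X)).toNat, h, fun w => ?_⟩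
  refine Int.toNat_of_nonneg ?_
  by_cases hw : v = w
  · subst hw
    rw [laplacian_self]
    omega
  · have h2 := laplacian_nonpos (G := G) (fun h => hw (Subtype.ext h) : (v : X) ≠ w)
    omega

theorem LegalToppling.add {v : W} {σ τ : W → ℕ} (h : LegalToppling G v σ τ) (x : W → ℕ) :
    LegalToppling G v (σ + x) (τ + x) := by
  refine ⟨h.1.trans (Nat.le_add_right _ _), fun w => ?_⟩
  have := h.2 w
  rw [Pi.add_apply, Pi.add_apply]
  push_cast
  omega

theorem LegalTopplings.add {l : List W} {σ τ : W → ℕ} (h : LegalTopplings G l σ τ)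
    (x : W → ℕ) : LegalTopplings G l (σ + x) (τ + x) := by
  induction h with
  | nil σ => exact .nil _
  | cons h _ ih => exact .cons (h.add x) ih

theorem LegalTopplings.append {l l' : List W} {σ τ ρ : W → ℕ} (h : LegalTopplings G l σ τ)
    (h' : LegalTopplings G l' τ ρ) : LegalTopplings G (l ++ l') σ ρ := by
  induction h with
  | nil σ => exact h'
  | cons h _ ih => exact .cons h (ih h')

/-- If `σ` has a stabilization, every vertex that can be toppled may be toppled first. -/
theorem LegalTopplings.exchange {l : List W} {σ τ : W → ℕ} (h : LegalTopplings G l σ τ)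
    (hτ : Stable G τ) {v : W} (hv : deg G (v : X) ≤ σ v) :
    ∃ l' σ', l.Perm (v :: l') ∧ LegalToppling G v σ σ' ∧ LegalTopplings G l' σ' τ := by
  induction h with
  | nil σ => exact absurd (hτ v) (by omega)
  | @cons w l σ ρ τ hw hl ih =>
    by_cases hvw : w = v
    · subst hvw
      exact ⟨l, ρ, List.Perm.refl _, hw, hl⟩
    -- A toppling at `w ≠ v` does not lower the height at `v`, so `v` stays unstable until its own
    -- first toppling, which can be commuted to the front.
    obtain ⟨l', ρ', hp, hv', hl'⟩ := ih hτ (hv.trans (hw.le_of_ne hvw))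
    obtain ⟨σ', hσ'⟩ := exists_legalToppling hv
    refine ⟨w :: l', σ', (hp.cons w).trans (List.Perm.swap _ _ _), hσ', .cons ⟨?_, fun x => ?_⟩ hl'⟩
    · exact hw.1.trans (hσ'.le_of_ne (Ne.symm hvw))
    · have h1 := hw.2 x
      have h2 := hv'.2 x
      have h3 := hσ'.2 x
      omega

/-- The abelian property: any legal sequence of topplings is an initial part of a rearrangement
of a stabilizing one. -/
theorem LegalTopplings.diamond {l l' : List W} {σ τ ρ : W → ℕ} (h' : LegalTopplings G l' σ ρ)
    (h : LegalTopplings G l σ τ) (hτ : Stable G τ) :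
    ∃ l'', l.Perm (l' ++ l'') ∧ LegalTopplings G l'' ρ τ := by
  induction h' generalizing l with
  | nil σ => exact ⟨l, List.Perm.refl _, h⟩
  | cons hv _ ih =>
    obtain ⟨l1, σ1, hp, hv1, hl1⟩ := h.exchange hτ hv.1
    obtain rfl := hv.unique hv1
    obtain ⟨l'', hp', hl''⟩ := ih hl1
    exact ⟨l'', hp.trans (hp'.cons _), hl''⟩

theorem LegalTopplings.eq_of_stable {l : List W} {σ τ : W → ℕ} (h : LegalTopplings G l σ τ)
    (hσ : Stable G σ) : τ = σ := by
  cases h with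
  | nil σ => rfl
  | @cons v l σ τ ρ h _ => exact absurd (hσ v) (not_lt.2 h.1)

theorem IsStabilization.unique {σ τ ρ : W → ℕ} (h : IsStabilization G σ τ)
    (h' : IsStabilization G σ ρ) : τ = ρ := by
  obtain ⟨⟨l, hl⟩, hτ⟩ := h
  obtain ⟨⟨l', hl'⟩, hρ⟩ := h'
  obtain ⟨l'', -, hl''⟩ := hl'.diamond hl hτ
  exact hl''.eq_of_stable hρ

theorem Stabilizes.not_explodes {σ : W → ℕ} [Nonempty W] (h : Stabilizes G σ) : ¬ Explodes G σ := by
  classical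
  rintro h'
  obtain ⟨τ, ⟨l, hl⟩, hτ⟩ := h
  obtain ⟨v⟩ := ‹Nonempty W›
  obtain ⟨l', ρ, hl', hc⟩ := h' v (l.length + 1)
  obtain ⟨l'', hp, -⟩ := hl'.diamond hl hτ
  have h1 := hp.length_eq
  rw [List.length_append] at h1
  have h2 : l'.count v ≤ l'.length := List.count_le_length
  have h3 : l.length + 1 ≤ l'.count v := by convert hc
  omega

/-- A list legal for `σ` is legal for `σ + x`, so `LegalTopplings.diamond` bounds its length by that
of a stabilizing list. Without stabilization there would be legal lists of every length. -/
theorem Stabilizes.of_add {σ x : W → ℕ} (h : Stabilizes G (σ + x)) : Stabilizes G σ := by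
  obtain ⟨τ, ⟨l, hl⟩, hτ⟩ := h
  by_contra hc
  have key : ∀ n : ℕ, ∃ l' ρ, LegalTopplings G l' σ ρ ∧ l'.length = n := by
    intro n
    induction n with
    | zero => exact ⟨[], σ, .nil _, rfl⟩
    | succ n ih =>
      obtain ⟨l', ρ, hl', hn⟩ := ih
      by_cases hs : Stable G ρ
      · exact absurd ⟨ρ, ⟨l', hl'⟩, hs⟩ hc
      simp only [Stable, not_forall, not_lt] at hs
      obtain ⟨v, hv⟩ := hs
      obtain ⟨ρ', hρ'⟩ := exists_legalToppling hv
      exact ⟨l' ++ [v], ρ', hl'.append (.cons hρ' (.nil _)), by simp [hn]⟩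
  obtain ⟨l', ρ, hl', hn⟩ := key (l.length + 1)
  obtain ⟨l'', hp, -⟩ := (hl'.add x).diamond hl hτ
  have h1 := hp.length_eq
  rw [List.length_append] at h1
  omega

end Abelian

/-! ### Reachability in the Markov chain as addition of particles -/

section Reachability

open Classical in
/-- One particle at each entry of a list. -/
noncomputable def particles (xs : List W) : W → ℕ := (xs.map fun v => Pi.single v 1).sum

theorem particles_nil : particles ([] : List W) = 0 := rfl

open Classical in
theorem particles_cons (v : W) (xs : List W) :
    particles (v :: xs) = Pi.single v 1 + particles xs := by
  simp [particles]

theorem particles_append (xs ys : List W) :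
    particles (xs ++ ys) = particles xs + particles ys := by
  simp [particles]

theorem exists_particles_eq [Finite W] (f : W → ℕ) : ∃ xs, particles xs = f := by
  classical
  cases nonempty_fintype W
  induction hn : ∑ v, f v generalizing f with
  | zero =>
    refine ⟨[], ?_⟩
    funext v
    have := Finset.sum_eq_zero_iff.1 hn v (Finset.mem_univ _)
    simp [particles, this]
  | succ n ih =>
    obtain ⟨v, -, hv⟩ : ∃ v ∈ Finset.univ, f v ≠ 0 := by
      apply Finset.exists_ne_zero_of_sum_ne_zero
      omega
    have hf : f = Pi.single v 1 + (f - Pi.single v 1) := by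
      funext w
      by_cases h : w = v
      · subst h
        simp
        omega
      · simp [h]
    obtain ⟨xs, hxs⟩ := ih (f - Pi.single v 1) (by
      have h2 : ∑ w, f w = ∑ w, ((Pi.single v 1 : W → ℕ) w + (f - (Pi.single v 1 : W → ℕ)) w) :=
        Finset.sum_congr rfl fun w _ => by
          exact congrFun hf w
      rw [Finset.sum_add_distrib, Finset.sum_pi_single'] at h2
      simp at h2
      simp only [Pi.sub_apply]
      omega)
    exact ⟨v :: xs, by rw [particles_cons, hxs, ← hf]⟩

theorem exists_isStabilization_of_reachable {σ τ : W → ℕ} (hσ : Stable G σ)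
    (h : Relation.ReflTransGen (Transition G) σ τ) :
    ∃ xs, IsStabilization G (σ + particles xs) τ := by
  classical
  induction h with
  | refl => exact ⟨[], ⟨[], .nil _⟩, hσ⟩
  | tail _ h ih =>
    obtain ⟨xs, ⟨l, hl⟩, -⟩ := ih
    obtain ⟨v, ⟨l', hl'⟩, hs⟩ := h
    refine ⟨v :: xs, ⟨l ++ l', ?_⟩, hs⟩
    have h1 := (hl.add (Pi.single v 1)).append hl'
    rwa [add_assoc, add_comm (particles xs), ← particles_cons] at h1

/-- By the abelian property one may stabilize after each single addition; the intermediate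
stabilizations exist by `Stabilizes.of_add`. -/
theorem reachable_of_isStabilization {σ τ : W → ℕ} (hσ : Stable G σ) {xs : List W}
    (h : IsStabilization G (σ + particles xs) τ) :
    Relation.ReflTransGen (Transition G) σ τ := by
  classical
  induction xs generalizing σ with
  | nil =>
    obtain ⟨⟨l, hl⟩, -⟩ := h
    rw [hl.eq_of_stable (by simpa [particles_nil] using hσ), particles_nil, add_zero]
  | cons v xs ih =>
    rw [particles_cons, ← add_assoc] at h
    obtain ⟨ρ, hρ⟩ := Stabilizes.of_add ⟨τ, h⟩
    refine .head ⟨v, hρ⟩ (ih hρ.2 ?_)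
    obtain ⟨⟨l, hl⟩, hτ⟩ := h
    obtain ⟨⟨l', hl'⟩, hs⟩ := hρ
    obtain ⟨l'', -, hl''⟩ := (hl'.add (particles xs)).diamond hl hτ
    exact ⟨⟨l'', hl''⟩, hτ⟩

end Reachability

/-! ### Forbidden subconfigurations and recurrence -/

section Allowed

open Classical in
/-- The number of neighbours of `v` in `F`. -/
noncomputable def degIn (G : SimpleGraph X) (F : Finset W) (v : W) : ℕ :=
  (F.filter fun w : W => G.Adj (v : X) (w : X)).card

/-- A sandpile is allowed if it has no forbidden subconfiguration. -/
def Allowed (G : SimpleGraph X) (σ : W → ℕ) : Prop :=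
  ∀ F : Finset W, F.Nonempty → ∃ v ∈ F, degIn G F v ≤ σ v

theorem Allowed.mono {σ τ : W → ℕ} (h : Allowed G σ) (hle : σ ≤ τ) : Allowed G τ := by
  intro F hF
  obtain ⟨v, hv, h⟩ := h F hF
  exact ⟨v, hv, h.trans (hle v)⟩

theorem degIn_erase [DecidableEq W] {F : Finset W} {v w : W} (hv : v ∈ F) (hw : w ≠ v) :
    (degIn G F w : ℤ) = degIn G (F.erase v) w - laplacian G (v : X) (w : X) := by
  have hne : (v : X) ≠ w := fun h => hw (Subtype.ext h).symm
  have hd : DecidablePred fun x : W => G.Adj (w : X) (x : X) := fun _ => Classical.propDecidable _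
  have key : ∀ F' : Finset W, degIn G F' w = (F'.filter fun x : W => G.Adj (w : X) (x : X)).card := by
    intro F'
    unfold degIn
    congr
  rw [key, key]
  unfold laplacian
  rw [if_neg hne, Finset.filter_erase]
  by_cases h : G.Adj (v : X) (w : X)
  · have hm : v ∈ F.filter fun x : W => G.Adj (w : X) (x : X) := Finset.mem_filter.2 ⟨hv, h.symm⟩
    rw [if_pos h, ← Finset.card_erase_add_one hm]
    push_cast
    ring
  · have hm : v ∉ F.filter fun x : W => G.Adj (w : X) (x : X) :=
      fun hm => h (Finset.mem_filter.1 hm).2.symm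
    rw [if_neg h, Finset.erase_eq_of_notMem hm]
    ring

/-- For `F` containing `v`, test the old sandpile on `F.erase v`: the particle that a neighbour
receives from `v` pays for the additional neighbour `v` in `F`. -/
theorem LegalToppling.allowed {v : W} {σ τ : W → ℕ} (h : LegalToppling G v σ τ)
    (hσ : Allowed G σ) : Allowed G τ := by
  classical
  intro F hF
  by_cases hv : v ∈ F
  · by_cases hne : (F.erase v).Nonempty
    · obtain ⟨w, hw, hle⟩ := hσ _ hne
      refine ⟨w, Finset.mem_of_mem_erase hw, ?_⟩
      have h1 := degIn_erase (G := G) hv (Finset.ne_of_mem_erase hw)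
      have h2 := h.2 w
      omega
    · rw [Finset.not_nonempty_iff_eq_empty, Finset.erase_eq_empty_iff] at hne
      rcases hne with rfl | rfl
      · simp at hF
      · refine ⟨v, hv, ?_⟩
        simp [degIn, Finset.filter_singleton]
  · obtain ⟨w, hw, hle⟩ := hσ F hF
    exact ⟨w, hw, hle.trans (h.le_of_ne fun h => hv (h ▸ hw))⟩

theorem LegalTopplings.allowed {l : List W} {σ τ : W → ℕ} (h : LegalTopplings G l σ τ)
    (hσ : Allowed G σ) : Allowed G τ := by
  induction h with
  | nil σ => exact hσ
  | cons h _ ih => exact ih (h.allowed hσ)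

/-- If particles can be added in fours without changing allowed sandpiles, then the recurrent
sandpiles are the stable allowed ones. -/
theorem recurrent_iff_allowed [Finite W] (hdeg : ∀ v : W, 0 < deg G (v : X))
    (hmax : Allowed G (W := W) fun v => deg G (v : X) - 1)
    (hfour : ∀ σ : W → ℕ, Stable G σ → Allowed G σ → ∀ v,
      ∃ l, LegalTopplings G l (σ + 4 • particles [v]) σ) (σ : W → ℕ) :
    Recurrent G σ ↔ Stable G σ ∧ Allowed G σ := by
  refine ⟨fun ⟨hs, h⟩ => ⟨hs, ?_⟩, fun ⟨hs, ha⟩ => ⟨hs, fun τ hτ => ?_⟩⟩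
  · obtain ⟨xs, hxs⟩ := exists_particles_eq (fun v : W => deg G (v : X) - 1 - σ v)
    have hm : Stable G (W := W) fun v => deg G (v : X) - 1 := fun v => by
      have := hdeg v
      simp only
      omega
    -- Filling up every vertex reaches the maximal stable sandpile, which is allowed. Recurrence
    -- leads back to `σ`, and additions and topplings preserve allowedness.
    have h1 := h (fun v => deg G (v : X) - 1) (reachable_of_isStabilization hs (xs := xs) (by
      have h2 : (σ + fun v : W => deg G (v : X) - 1 - σ v) = fun v : W => deg G (v : X) - 1 := by
        funext v
        have := hs v
        rw [Pi.add_apply]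
        omega
      rw [hxs, h2]
      exact ⟨⟨[], .nil _⟩, hm⟩))
    obtain ⟨ys, ⟨l, hl⟩, -⟩ := exists_isStabilization_of_reachable hm h1
    exact hl.allowed (hmax.mono fun _ => Nat.le_add_right _ _)
  · obtain ⟨xs, ⟨l, hl⟩, hτs⟩ := exists_isStabilization_of_reachable hs hτ
    have h4 : ∀ ys : List W, ∃ l, LegalTopplings G l (σ + 4 • particles ys) σ := by
      intro ys
      induction ys with
      | nil => exact ⟨[], by simpa [particles_nil] using LegalTopplings.nil (G := G) σ⟩
      | cons v ys ih =>
        obtain ⟨l1, h1⟩ := ih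
        obtain ⟨l2, h2⟩ := hfour σ hs ha v
        refine ⟨l1 ++ l2, ?_⟩
        have h3 := (h1.add (4 • particles [v])).append h2
        rwa [add_assoc, ← smul_add, ← particles_append,
          show particles (ys ++ [v]) = particles (v :: ys) by
            rw [particles_append, particles_cons v ys, particles_cons, particles_nil, add_zero,
              add_comm]] at h3
    obtain ⟨l4, hl4⟩ := h4 xs
    -- One of the four copies has been used to reach `τ`; the other three lead from `τ` back to `σ`.
    have h5 : (4 : ℕ) • particles xs = particles xs + particles (xs ++ (xs ++ xs)) := by
      rw [particles_append, particles_append]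
      ring
    rw [h5, ← add_assoc] at hl4
    obtain ⟨l5, -, hl5⟩ := (hl.add (particles (xs ++ (xs ++ xs)))).diamond hl4 hs
    exact reachable_of_isStabilization hτs ⟨⟨l5, hl5⟩, hs⟩

end Allowed

end Sandpile

namespace Sandpile

variable {X : Type*} {G : SimpleGraph X} {W : Set X}

/-! ### Dhar's burning test -/

section Burning

theorem sum_laplacian [DecidableEq W] (D : Finset W) (x : W) :
    ∑ w ∈ D, laplacian G (w : X) (x : X) = (if x ∈ D then (deg G (x : X) : ℤ) else 0) - degIn G D x := by
  classical
  have h1 : ∀ w : W, laplacian G (w : X) (x : X)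
      = (if w = x then (deg G (x : X) : ℤ) else 0) - if G.Adj (x : X) (w : X) then 1 else 0 := by
    intro w
    unfold laplacian
    by_cases h : w = x
    · subst h
      simp
    · have h' : (w : X) ≠ x := fun e => h (Subtype.ext e)
      by_cases ha : G.Adj (x : X) (w : X)
      · simp [h, h', ha, ha.symm]
      · have ha' : ¬ G.Adj (w : X) (x : X) := fun e => ha e.symm
        simp [h, h', ha, ha']
  rw [Finset.sum_congr rfl fun w _ => h1 w, Finset.sum_sub_distrib, Finset.sum_ite_eq' D x]
  congr 1
  simp only [degIn, Finset.card_filter]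
  push_cast
  exact Finset.sum_congr rfl fun w _ => by congr

theorem degIn_union_sdiff [DecidableEq W] {F D : Finset W} (h : F ⊆ D) (v : W) :
    degIn G D v = degIn G F v + degIn G (D \ F) v := by
  classical
  unfold degIn
  rw [← Finset.card_union_of_disjoint, ← Finset.filter_union, Finset.union_sdiff_of_subset h]
  exact Finset.disjoint_filter_filter Finset.disjoint_sdiff

/-- If no subset of `D` can resist burning, all vertices of `D` can be toppled once. -/
theorem exists_burning [DecidableEq W] (D : Finset W) {σ : W → ℕ}
    (h : ∀ F ⊆ D, F.Nonempty → ∃ w ∈ F, deg G (w : X) ≤ σ w + degIn G (D \ F) w) :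
    ∃ l τ, LegalTopplings G l σ τ ∧ (∀ x, x ∈ l ↔ x ∈ D) ∧
      ∀ x : W, (τ x : ℤ) = σ x - ∑ w ∈ D, laplacian G (w : X) (x : X) := by
  induction hn : D.card generalizing D σ with
  | zero =>
    rw [Finset.card_eq_zero] at hn
    subst hn
    exact ⟨[], σ, .nil _, by simp, by simp⟩
  | succ n ih =>
    have hD : D.Nonempty := Finset.card_pos.1 (by omega)
    -- For `F = D` nothing has burnt yet, so this vertex is already unstable. After its toppling the
    -- hypothesis holds for `D.erase v`.
    obtain ⟨v, hv, hle⟩ := h D subset_rfl hD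
    rw [sdiff_self] at hle
    obtain ⟨ρ, hρ⟩ := exists_legalToppling (G := G) (v := v) (σ := σ) (by simpa [degIn] using hle)
    obtain ⟨l, τ, hl, hm, hτ⟩ := ih (D.erase v) (σ := ρ) (by
      intro F hF hFn
      obtain ⟨w, hw, hle⟩ := h F (hF.trans (Finset.erase_subset _ _)) hFn
      refine ⟨w, hw, ?_⟩
      have hvF : v ∉ F := fun h => Finset.notMem_erase v D (hF h)
      have hwv : w ≠ v := fun h => hvF (h ▸ hw)
      have h1 := degIn_erase (G := G) (Finset.mem_sdiff.2 ⟨hv, hvF⟩) hwv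
      have h2 := hρ.2 w
      rw [Finset.erase_sdiff_comm]
      omega) (by rw [Finset.card_erase_of_mem hv, hn]; rfl)
    refine ⟨v :: l, τ, .cons hρ hl, fun x => ?_, fun x => ?_⟩
    · rw [List.mem_cons, hm, Finset.mem_erase]
      by_cases hx : x = v
      · simp [hx, hv]
      · simp [hx]
    · rw [hτ, hρ.2, ← Finset.add_sum_erase D _ hv]
      ring

end Burning

/-! ### Trees of cells: decomposition of allowed sandpiles and toppling of whole branches -/

/-- A tree-like arrangement of complete graphs on four vertices. Each cell consists of a root and
three sites; the root is a site of a higher cell, or lies outside `W`. -/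
structure CellStructure (G : SimpleGraph X) (W : Set X) (C : Type*) where
  site : C × Fin 3 ≃ W
  root : C → X
  height : C → ℕ
  adj_iff : ∀ (v : W) (x : X), G.Adj (v : X) x ↔ x = root (site.symm v).1 ∨
    ∃ w : W, (w : X) = x ∧ w ≠ v ∧
      ((site.symm w).1 = (site.symm v).1 ∨ root (site.symm w).1 = (v : X))
  height_lt : ∀ c (w : W), (w : X) = root c → height c < height (site.symm w).1
  finite_closed : ∀ v : W, ∃ D : Set W, D.Finite ∧ v ∈ D ∧
    ∀ x w : W, root (site.symm x).1 = (w : X) → w ∈ D → x ∈ D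

/-- Sandpiles on the complete graph on four vertices, with one vertex as the sink, that are
stable and without forbidden subconfiguration. -/
def IsCellRecurrent (f : Fin 3 → ℕ) : Prop :=
  (∀ j, f j < 3) ∧ ∀ A : Finset (Fin 3), A.Nonempty → ∃ j ∈ A, A.card ≤ f j + 1

/-- The toppling at `i` in the complete graph on four vertices. -/
def cellTopple (i : Fin 3) (f : Fin 3 → ℕ) : Fin 3 → ℕ :=
  fun j => if j = i then f j - 3 else f j + 1

namespace CellStructure

variable {C : Type*} (S : CellStructure G W C)

/-- The cell of which `v` is a site. -/
def cell (v : W) : C := (S.site.symm v).1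

/-- The sites of the cells whose root is `v`. -/
def children (v : W) : Set W := {w | S.root (S.cell w) = (v : X)}

/-- `x` is `v` or lies behind `v`. -/
def Desc (x v : W) : Prop :=
  Relation.ReflTransGen (fun x w : W => S.root (S.cell x) = (w : X)) x v

theorem cell_site (c : C) (i : Fin 3) : S.cell (S.site (c, i)) = c := by simp [cell]

theorem adj (v : W) (x : X) : G.Adj (v : X) x ↔ x = S.root (S.cell v) ∨
    ∃ w : W, (w : X) = x ∧ w ≠ v ∧ (S.cell w = S.cell v ∨ w ∈ S.children v) := S.adj_iff v x

theorem height_root {c : C} {w : W} (h : S.root c = (w : X)) : S.height c < S.height (S.cell w) :=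
  S.height_lt c w h.symm

theorem exists_site {c : C} {w : W} (h : S.cell w = c) : ∃ j, S.site (c, j) = w :=
  ⟨(S.site.symm w).2, by rw [← h]; simp [cell]⟩

theorem desc_height {x v : W} (h : S.Desc x v) : x = v ∨ S.height (S.cell x) < S.height (S.cell v) := by
  induction h with
  | refl => exact .inl rfl
  | tail _ h ih =>
    right
    have := S.height_root h
    rcases ih with rfl | ih
    · exact this
    · exact ih.trans this

theorem desc_finite (v : W) : {x | S.Desc x v}.Finite := by
  obtain ⟨D, hD, hv, hc⟩ := S.finite_closed v
  refine hD.subset fun x hx => ?_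
  induction hx using Relation.ReflTransGen.head_induction_on with
  | refl => exact hv
  | head h _ ih => exact hc _ _ h ih

theorem children_finite (v : W) : (S.children v).Finite :=
  (S.desc_finite v).subset fun _ h => .single h

/-- The part behind `v` can be left only through `v`: for a strict descendant the root, the other
sites of its cell and its children all lie behind `v`. -/
theorem adj_of_desc {v w : W} (hw : S.Desc w v) (hne : w ≠ v) {y : X} (hy : G.Adj (w : X) y) :
    ∃ z : W, (z : X) = y ∧ S.Desc z v := by
  rcases Relation.ReflTransGen.cases_head hw with rfl | ⟨u, hu, huv⟩
  · exact absurd rfl hne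
  rcases (S.adj w y).1 hy with rfl | ⟨z, rfl, -, hz | hz⟩
  · exact ⟨u, hu.symm, huv⟩
  · exact ⟨z, rfl, .head (by rw [hz]; exact hu) huv⟩
  · exact ⟨z, rfl, .head hz hw⟩

open Classical in
theorem neighborSet_eq (c : C) (i : Fin 3) :
    G.neighborSet (S.site (c, i) : X) = insert (S.root c)
      ((fun w : W => (w : X)) '' (((Finset.univ.erase i).image fun j => S.site (c, j) : Finset W) ∪
        S.children (S.site (c, i)))) := by
  ext x
  rw [SimpleGraph.mem_neighborSet, S.adj, S.cell_site, Set.mem_insert_iff]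
  refine or_congr_right ⟨?_, ?_⟩
  · rintro ⟨w, rfl, hne, h | h⟩
    · obtain ⟨j, rfl⟩ := S.exists_site h
      refine ⟨_, .inl ?_, rfl⟩
      simp only [Finset.coe_image, Set.mem_image, Finset.mem_coe, Finset.mem_erase]
      exact ⟨j, ⟨fun h => hne (by rw [h]), Finset.mem_univ _⟩, rfl⟩
    · exact ⟨w, .inr h, rfl⟩
  · rintro ⟨w, h | h, rfl⟩
    · simp only [Finset.coe_image, Set.mem_image, Finset.mem_coe, Finset.mem_erase] at h
      obtain ⟨j, ⟨hj, -⟩, rfl⟩ := h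
      exact ⟨_, rfl, fun h => hj (by simpa using h), .inl (S.cell_site _ _)⟩
    · refine ⟨w, rfl, ?_, .inr h⟩
      rintro rfl
      exact lt_irrefl _ (S.height_root h)

theorem deg_eq (v : W) : deg G (v : X) = 3 + (S.children v).ncard := by
  classical
  obtain ⟨⟨c, i⟩, rfl⟩ := S.site.surjective v
  rw [deg, S.neighborSet_eq]
  have hf := S.children_finite (S.site (c, i))
  have hinj : Function.Injective fun w : W => (w : X) := Subtype.val_injective
  rw [Set.ncard_insert_of_notMem ?_ (((Finset.finite_toSet _).union hf).image _),
    Set.ncard_image_of_injective _ hinj, Set.ncard_union_eq ?_ (Finset.finite_toSet _) hf,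
    Set.ncard_coe_finset, Finset.card_image_of_injective]
  · simp
    omega
  · intro a b h
    simpa using h
  · rw [Set.disjoint_left]
    intro w hw hw'
    simp only [Finset.coe_image, Set.mem_image, Finset.mem_coe] at hw
    obtain ⟨j, -, rfl⟩ := hw
    have := S.height_root hw'
    simp [S.cell_site] at this
  · rintro ⟨w, hw | hw, h⟩
    · simp only [Finset.coe_image, Set.mem_image, Finset.mem_coe] at hw
      obtain ⟨j, -, rfl⟩ := hw
      have := S.height_root h.symm
      simp [S.cell_site] at this
    · have h1 := S.height_root h.symm
      have h2 := S.height_root hw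
      rw [S.cell_site] at h2
      omega

theorem degIn_eq_deg {v : W} {F : Finset W} (h : ∀ y, G.Adj (v : X) y → ∃ z ∈ F, (z : X) = y) :
    degIn G F v = deg G (v : X) := by
  classical
  rw [deg, degIn, ← Finset.card_image_of_injective _ Subtype.val_injective, ← Set.ncard_coe_finset]
  congr 1
  ext x
  simp only [Finset.coe_image, Set.mem_image, Finset.mem_coe, Finset.mem_filter,
    SimpleGraph.mem_neighborSet]
  constructor
  · rintro ⟨w, ⟨-, hw⟩, rfl⟩
    exact hw
  · intro hx
    obtain ⟨z, hz, rfl⟩ := h x hx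
    exact ⟨z, ⟨hz, hx⟩, rfl⟩

/-- The sandpile with `κ c i` particles at a site, not counting one particle for each site behind
it that is adjacent to it. -/
noncomputable def load (κ : C → Fin 3 → ℕ) : W → ℕ :=
  fun v => κ (S.cell v) (S.site.symm v).2 + (deg G (v : X) - 3)

theorem load_site (κ : C → Fin 3 → ℕ) (c : C) (i : Fin 3) :
    S.load κ (S.site (c, i)) = κ c i + (S.children (S.site (c, i))).ncard := by
  simp [load, cell, S.deg_eq]

theorem stable_load {κ : C → Fin 3 → ℕ} : Stable G (S.load κ) ↔ ∀ c i, κ c i < 3 := by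
  constructor
  · intro h c i
    have := h (S.site (c, i))
    rw [S.load_site, S.deg_eq] at this
    omega
  · intro h v
    obtain ⟨⟨c, i⟩, rfl⟩ := S.site.surjective v
    rw [S.load_site, S.deg_eq]
    have := h c i
    omega

theorem load_injective : Function.Injective S.load := by
  intro κ κ' h
  funext c i
  have := congrFun h (S.site (c, i))
  rw [S.load_site, S.load_site] at this
  omega

/-- In a cell of maximal height among those meeting `F`, the root is not in `F`. A site there has in
`F` only sites of its cell and children as neighbours; the cell condition pays for the former, the
extra term in `load` for the latter. -/
theorem exists_degIn_le {κ : C → Fin 3 → ℕ} {F : Finset W} (hF : F.Nonempty)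
    (h : ∀ v ∈ F, IsCellRecurrent (κ (S.cell v))) : ∃ v ∈ F, degIn G F v ≤ S.load κ v := by
  classical
  obtain ⟨v, hv, hmax⟩ := F.exists_max_image (fun v => S.height (S.cell v)) hF
  obtain ⟨⟨c, i⟩, rfl⟩ := S.site.surjective v
  have hg := h _ hv
  rw [S.cell_site] at hg hmax
  let A : Finset (Fin 3) := Finset.univ.filter fun j => S.site (c, j) ∈ F
  obtain ⟨j, hj, hle⟩ := hg.2 A ⟨i, by simp [A, hv]⟩
  have hjF : S.site (c, j) ∈ F := (Finset.mem_filter.1 hj).2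
  refine ⟨_, hjF, ?_⟩
  rw [S.load_site]
  have hsub : F.filter (fun w : W => G.Adj (S.site (c, j) : X) (w : X)) ⊆
      (A.erase j).image (fun k => S.site (c, k)) ∪ (S.children_finite (S.site (c, j))).toFinset := by
    intro w hw
    obtain ⟨hwF, hadj⟩ := Finset.mem_filter.1 hw
    rw [S.adj, S.cell_site] at hadj
    rcases hadj with hr | ⟨w', hw', hne, h | h⟩
    · have h1 := S.height_root hr.symm
      have h2 := hmax w hwF
      omega
    · obtain rfl := Subtype.ext hw'
      obtain ⟨k, rfl⟩ := S.exists_site h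
      refine Finset.mem_union_left _ (Finset.mem_image.2 ⟨k, ?_, rfl⟩)
      refine Finset.mem_erase.2 ⟨fun h => hne (by rw [h]), ?_⟩
      simp [A, hwF]
    · obtain rfl := Subtype.ext hw'
      exact Finset.mem_union_right _ (by simpa using h)
  have h1 := (Finset.card_le_card hsub).trans (Finset.card_union_le _ _)
  have h2 := Finset.card_image_le (s := A.erase j) (f := fun k => S.site (c, k))
  rw [Finset.card_erase_of_mem hj] at h2
  rw [← Set.ncard_eq_toFinset_card _ (S.children_finite _)] at h1
  have h3 : 0 < A.card := Finset.card_pos.2 ⟨j, hj⟩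
  have h4 : degIn G F (S.site (c, j))
      = (F.filter (fun w : W => G.Adj (S.site (c, j) : X) (w : X))).card := by
    unfold degIn
    congr
  omega

theorem allowed_load {κ : C → Fin 3 → ℕ} (h : ∀ c, IsCellRecurrent (κ c)) :
    Allowed G (S.load κ) := fun _ hF => S.exists_degIn_le hF fun _ _ => h _

/-- Allowedness is tested on all that lies at or behind a set `A` of sites of one cell. Strict
descendants have all their neighbours in this set, so stability rules them out as witnesses, and the
witness is a site in `A`, with `A.card - 1` neighbours in `A` besides its children. -/
theorem exists_load_eq {σ : W → ℕ} (hs : Stable G σ) (ha : Allowed G σ) :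
    ∃ κ : C → Fin 3 → ℕ, (∀ c, IsCellRecurrent (κ c)) ∧ S.load κ = σ := by
  classical
  have key : ∀ (c : C) (A : Finset (Fin 3)), A.Nonempty →
      ∃ j ∈ A, A.card + (S.children (S.site (c, j))).ncard ≤ σ (S.site (c, j)) + 1 := by
    intro c A hA
    have hfin : (⋃ j ∈ A, {x | S.Desc x (S.site (c, j))}).Finite :=
      Set.Finite.biUnion (Finset.finite_toSet A) fun j _ => S.desc_finite _
    have hmem : ∀ x, x ∈ hfin.toFinset ↔ ∃ j ∈ A, S.Desc x (S.site (c, j)) := by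
      intro x
      simp
    obtain ⟨i, hi⟩ := hA
    obtain ⟨w, hw, hle⟩ := ha hfin.toFinset ⟨S.site (c, i), (hmem _).2 ⟨i, hi, .refl⟩⟩
    obtain ⟨j, hj, hwj⟩ := (hmem w).1 hw
    by_cases hne : w = S.site (c, j)
    · subst hne
      refine ⟨j, hj, ?_⟩
      have hsub : (A.erase j).image (fun k => S.site (c, k)) ∪
          (S.children_finite (S.site (c, j))).toFinset ⊆
          hfin.toFinset.filter (fun w : W => G.Adj (S.site (c, j) : X) (w : X)) := by
        intro w hw
        rw [Finset.mem_filter, hmem, S.adj, S.cell_site]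
        rcases Finset.mem_union.1 hw with hw | hw
        · obtain ⟨k, hk, rfl⟩ := Finset.mem_image.1 hw
          obtain ⟨hkj, hk⟩ := Finset.mem_erase.1 hk
          exact ⟨⟨k, hk, .refl⟩, .inr ⟨_, rfl, fun h => hkj (by simpa using h),
            .inl (S.cell_site _ _)⟩⟩
        · have hw' : w ∈ S.children (S.site (c, j)) := by simpa using hw
          refine ⟨⟨j, hj, .single hw'⟩, .inr ⟨_, rfl, ?_, .inr hw'⟩⟩
          rintro rfl
          exact lt_irrefl _ (S.height_root hw')
      have h1 := Finset.card_le_card hsub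
      rw [Finset.card_union_of_disjoint, Finset.card_image_of_injective,
        Finset.card_erase_of_mem hj, ← Set.ncard_eq_toFinset_card _ (S.children_finite _)] at h1
      · have h4 : degIn G hfin.toFinset (S.site (c, j)) = (hfin.toFinset.filter
            (fun w : W => G.Adj (S.site (c, j) : X) (w : X))).card := by
          unfold degIn
          congr
        have h3 : 0 < A.card := Finset.card_pos.2 ⟨j, hj⟩
        omega
      · intro a b h
        simpa using h
      · rw [Finset.disjoint_left]
        intro w hw hw'
        obtain ⟨k, -, rfl⟩ := Finset.mem_image.1 hw
        have hw'' : S.site (c, k) ∈ S.children (S.site (c, j)) := by simpa using hw'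
        have := S.height_root hw''
        simp [S.cell_site] at this
    · exfalso
      have h1 : degIn G hfin.toFinset w = deg G (w : X) := degIn_eq_deg fun y hy => by
        obtain ⟨z, hz, hd⟩ := S.adj_of_desc hwj hne hy
        exact ⟨z, (hmem z).2 ⟨j, hj, hd⟩, hz⟩
      have h2 := hs w
      omega
  refine ⟨fun c i => σ (S.site (c, i)) - (S.children (S.site (c, i))).ncard,
    fun c => ⟨fun j => ?_, fun A hA => ?_⟩, ?_⟩
  · have h1 := hs (S.site (c, j))
    rw [S.deg_eq] at h1
    dsimp only
    omega
  · obtain ⟨j, hj, hle⟩ := key c A hA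
    have h3 : 0 < A.card := Finset.card_pos.2 hA
    refine ⟨j, hj, ?_⟩
    dsimp only
    omega
  · funext v
    obtain ⟨⟨c, i⟩, rfl⟩ := S.site.surjective v
    rw [S.load_site]
    -- A singleton shows that a site holds at least as many particles as it has children, so the
    -- truncated subtraction is exact.
    obtain ⟨j, hj, hle⟩ := key c {i} (Finset.singleton_nonempty i)
    rw [Finset.mem_singleton] at hj
    subst hj
    rw [Finset.card_singleton] at hle
    omega

open Classical in
/-- `m` particles at the root of `c`. -/
noncomputable def atRoot (c : C) (m : ℕ) : W → ℕ := fun w => if (w : X) = S.root c then m else 0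

theorem atRoot_add (c : C) (m n : ℕ) : S.atRoot c (m + n) = S.atRoot c m + S.atRoot c n := by
  funext w
  simp only [atRoot, Pi.add_apply]
  split_ifs <;> simp

theorem atRoot_zero (c : C) : S.atRoot c 0 = (0 : W → ℕ) := by
  funext w
  simp [atRoot]

/-- Toppling a site and everything behind it once acts like a single toppling within its cell. -/
theorem exists_legalTopplings_cellTopple [DecidableEq C] {κ : C → Fin 3 → ℕ} {c : C} {i : Fin 3}
    (h3 : 3 ≤ κ c i) (hg : ∀ c', S.height c' < S.height c → IsCellRecurrent (κ c')) :
    ∃ l, LegalTopplings G l (S.load κ)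
      (S.load (Function.update κ c (cellTopple i (κ c))) + S.atRoot c 1) ∧
      ∀ x, S.Desc x (S.site (c, i)) → x ∈ l := by
  classical
  set v := S.site (c, i) with hv
  set D := (S.desc_finite v).toFinset with hD
  have hmem : ∀ x, x ∈ D ↔ S.Desc x v := by simp [hD]
  have hdegIn : ∀ x ∈ D, x ≠ v → degIn G D x = deg G (x : X) := fun x hx hne =>
    degIn_eq_deg fun y hy => by
      obtain ⟨z, hz, hd⟩ := S.adj_of_desc ((hmem x).1 hx) hne hy
      exact ⟨z, (hmem z).2 hd, hz⟩
  have hcv : S.cell v = c := S.cell_site _ _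
  obtain ⟨l, τ, hl, hlm, hτ⟩ := exists_burning (G := G) D (σ := S.load κ) (by
    intro F hF hFn
    -- While `v` has not burnt, it can topple because `κ c i ≥ 3`. Once it has, what remains lies in
    -- lower, recurrent cells, and all neighbours of its vertices are in `D`.
    by_cases hvF : v ∈ F
    · refine ⟨v, hvF, ?_⟩
      rw [hv, S.load_site, S.deg_eq]
      omega
    · obtain ⟨w, hw, hle⟩ := S.exists_degIn_le (κ := κ) hFn (by
        intro x hx
        rcases S.desc_height ((hmem x).1 (hF hx)) with rfl | h
        · exact absurd hx hvF
        · exact hg _ (hcv ▸ h))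
      refine ⟨w, hw, ?_⟩
      rw [← hdegIn w (hF hw) (fun h => hvF (h ▸ hw)), degIn_union_sdiff hF]
      omega)
  refine ⟨l, ?_, fun x hx => (hlm x).2 ((hmem x).2 hx)⟩
  convert hl using 1
  funext x
  have hx := hτ x
  rw [sum_laplacian] at hx
  zify
  rw [hx]
  obtain ⟨⟨c', j⟩, rfl⟩ := S.site.surjective x
  rw [Pi.add_apply, S.load_site, S.load_site]
  -- Inside `D`, strict descendants lose and regain their degree, while `v` regains one particle per
  -- child and loses three in total. Outside `D`, only neighbours of `v` gain: the other sites of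
  -- the cell and the root.
  by_cases hxD : S.site (c', j) ∈ D
  · rw [if_pos hxD]
    have hroot : (S.site (c', j) : X) ≠ S.root c := by
      intro h
      have h1 := S.height_root h.symm
      rcases S.desc_height ((hmem _).1 hxD) with h2 | h2
      · rw [h2, hcv] at h1
        omega
      · rw [hcv] at h2
        omega
    rw [atRoot, if_neg hroot]
    by_cases hne : S.site (c', j) = v
    · rw [hv] at hne
      have hcc : c' = c ∧ j = i := by simpa using hne
      obtain ⟨rfl, rfl⟩ := hcc
      have hd : degIn G D v = (S.children v).ncard := by
        have : D.filter (fun w : W => G.Adj (v : X) (w : X)) = (S.children_finite v).toFinset := by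
          ext w
          rw [Finset.mem_filter, hmem, S.adj, Set.Finite.mem_toFinset, hcv]
          constructor
          · rintro ⟨hwd, h | ⟨w', hw', hne, h | h⟩⟩
            · have h1 := S.height_root h.symm
              rcases S.desc_height hwd with rfl | h2
              · rw [hcv] at h1
                omega
              · rw [hcv] at h2
                omega
            · obtain rfl := Subtype.ext hw'
              rcases S.desc_height hwd with h2 | h2
              · exact absurd h2 hne
              · rw [hcv, h] at h2
                omega
            · obtain rfl := Subtype.ext hw'
              exact h
          · intro h
            refine ⟨.single h, .inr ⟨w, rfl, ?_, .inr h⟩⟩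
            rintro rfl
            exact lt_irrefl _ (S.height_root h)
        rw [Set.ncard_eq_toFinset_card _ (S.children_finite _), ← this]
        unfold degIn
        congr
      rw [← hv, hd, S.deg_eq]
      simp [cellTopple]
      omega
    · rw [hdegIn _ hxD hne]
      have hc' : c' ≠ c := by
        rintro rfl
        rcases S.desc_height ((hmem _).1 hxD) with h2 | h2
        · exact hne h2
        · rw [hcv, S.cell_site] at h2
          omega
      rw [Function.update_of_ne hc']
      simp
  · rw [if_neg hxD]
    have hd : degIn G D (S.site (c', j)) =
        if c' = c ∨ (S.site (c', j) : X) = S.root c then 1 else 0 := by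
      have : D.filter (fun w : W => G.Adj (S.site (c', j) : X) (w : X)) =
          if c' = c ∨ (S.site (c', j) : X) = S.root c then {v} else ∅ := by
        have hvx : v ≠ S.site (c', j) := fun h => hxD (h ▸ (hmem v).2 .refl)
        have hadj : ∀ w ∈ D, G.Adj (S.site (c', j) : X) (w : X) → w = v := by
          intro w hw ha
          by_contra hne
          obtain ⟨z, hz, hd⟩ := S.adj_of_desc ((hmem w).1 hw) hne ha.symm
          exact hxD ((hmem _).2 (Subtype.ext hz ▸ hd))
        have hadjv : G.Adj (S.site (c', j) : X) (v : X) ↔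
            c' = c ∨ (S.site (c', j) : X) = S.root c := by
          rw [SimpleGraph.adj_comm, S.adj, hcv]
          constructor
          · rintro (h | ⟨w, hw, hne, h | h⟩)
            · exact .inr h
            · obtain rfl := Subtype.ext hw
              rw [S.cell_site] at h
              exact .inl h
            · obtain rfl := Subtype.ext hw
              exact absurd ((hmem _).2 (.single h)) hxD
          · rintro (h | h)
            · exact .inr ⟨_, rfl, hvx.symm, .inl (by rw [S.cell_site, h])⟩
            · exact .inl h
        ext w
        rw [Finset.mem_filter]
        split_ifs with h
        · rw [Finset.mem_singleton]
          refine ⟨fun h => hadj w h.1 h.2, ?_⟩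
          rintro rfl
          exact ⟨(hmem _).2 .refl, hadjv.2 h⟩
        · simp only [Finset.notMem_empty, iff_false]
          rintro ⟨h1, h2⟩
          obtain rfl := hadj w h1 h2
          exact h (hadjv.1 h2)
      have h4 : degIn G D (S.site (c', j)) = (D.filter
          (fun w : W => G.Adj (S.site (c', j) : X) (w : X))).card := by
        unfold degIn
        congr
      rw [h4, this]
      split_ifs <;> simp
    rw [hd, atRoot]
    by_cases hc' : c' = c
    · subst hc'
      have hroot : (S.site (c', j) : X) ≠ S.root c' := by
        intro h
        have h1 := S.height_root h.symm
        rw [S.cell_site] at h1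
        omega
      have hji : j ≠ i := fun h => hxD ((hmem _).2 (by rw [h]; exact .refl))
      simp [hroot, cellTopple, hji]
      ring
    · rw [Function.update_of_ne hc']
      simp only [hc', false_or]
      split_ifs <;> simp

end CellStructure

end Sandpile

namespace Sandpile

/-! ### Finite computations in one cell -/

section CellComputation

/-- `CellRun f m g`: within a cell, `m` legal topplings turn `f` into `g`. -/
inductive CellRun : (Fin 3 → ℕ) → ℕ → (Fin 3 → ℕ) → Prop
  | refl (f : Fin 3 → ℕ) : CellRun f 0 f
  | step {f g : Fin 3 → ℕ} {m : ℕ} (i : Fin 3) :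
      3 ≤ f i → CellRun (cellTopple i f) m g → CellRun f (m + 1) g

/-- Greedy stabilization of a cell, with the number of topplings. -/
def cellSettle : ℕ → ℕ → ℕ → ℕ → (ℕ × ℕ × ℕ) × ℕ
  | 0, a, b, c => ((a, b, c), 0)
  | n + 1, a, b, c =>
    if 3 ≤ a then ((cellSettle n (a - 3) (b + 1) (c + 1)).1, (cellSettle n (a - 3) (b + 1) (c + 1)).2 + 1)
    else if 3 ≤ b then
      ((cellSettle n (a + 1) (b - 3) (c + 1)).1, (cellSettle n (a + 1) (b - 3) (c + 1)).2 + 1)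
    else if 3 ≤ c then
      ((cellSettle n (a + 1) (b + 1) (c - 3)).1, (cellSettle n (a + 1) (b + 1) (c - 3)).2 + 1)
    else ((a, b, c), 0)

theorem cellTopple_zero (a b c : ℕ) : cellTopple 0 ![a, b, c] = ![a - 3, b + 1, c + 1] := by
  funext j
  fin_cases j <;> rfl

theorem cellTopple_one (a b c : ℕ) : cellTopple 1 ![a, b, c] = ![a + 1, b - 3, c + 1] := by
  funext j
  fin_cases j <;> rfl

theorem cellTopple_two (a b c : ℕ) : cellTopple 2 ![a, b, c] = ![a + 1, b + 1, c - 3] := by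
  funext j
  fin_cases j <;> rfl

theorem cellRun_cellSettle (n a b c : ℕ) :
    CellRun ![a, b, c] (cellSettle n a b c).2
      ![(cellSettle n a b c).1.1, (cellSettle n a b c).1.2.1, (cellSettle n a b c).1.2.2] := by
  induction n generalizing a b c with
  | zero => exact .refl _
  | succ n ih =>
    unfold cellSettle
    split_ifs with h1 h2 h3
    · exact .step 0 h1 (by rw [cellTopple_zero]; exact ih _ _ _)
    · exact .step 1 h2 (by rw [cellTopple_one]; exact ih _ _ _)
    · exact .step 2 h3 (by rw [cellTopple_two]; exact ih _ _ _)
    · exact .refl _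

/-- The number of particles that reach the root of a cell when `k` particles are added at the site
opposite to it. -/
def cellOut (k : ℕ) (f : Fin 3 → ℕ) : ℕ := (cellSettle 9 (f 0 + k) (f 1) (f 2)).2

instance (f : Fin 3 → ℕ) : Decidable (IsCellRecurrent f) := by
  unfold IsCellRecurrent
  infer_instance

theorem IsCellRecurrent.exists_fin {f : Fin 3 → ℕ} (h : IsCellRecurrent f) :
    ∃ a b c : Fin 3, f = ![(a : ℕ), b, c] := by
  refine ⟨⟨f 0, h.1 0⟩, ⟨f 1, h.1 1⟩, ⟨f 2, h.1 2⟩, ?_⟩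
  funext j
  fin_cases j <;> rfl

/-- Stability of the result certifies that nine steps of fuel suffice for up to four added
particles. -/
theorem isCellRecurrent_cellSettle : ∀ a b c : Fin 3, IsCellRecurrent ![(a : ℕ), b, c] →
    ∀ k : Fin 5, IsCellRecurrent ![(cellSettle 9 (a + k) b c).1.1,
      (cellSettle 9 (a + k) b c).1.2.1, (cellSettle 9 (a + k) b c).1.2.2] := by
  decide +kernel

theorem exists_cellRun_cellOut {f : Fin 3 → ℕ} (hf : IsCellRecurrent f) {k : ℕ} (hk : k ≤ 4) :
    ∃ g, IsCellRecurrent g ∧ CellRun (f + Pi.single 0 k) (cellOut k f) g := by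
  obtain ⟨a, b, c, rfl⟩ := hf.exists_fin
  refine ⟨_, isCellRecurrent_cellSettle a b c hf ⟨k, by omega⟩, ?_⟩
  have h : (![(a : ℕ), b, c] + Pi.single 0 k : Fin 3 → ℕ) = ![(a : ℕ) + k, b, c] := by
    funext j
    fin_cases j <;> simp
  rw [h]
  exact cellRun_cellSettle _ _ _ _

/-- One extra particle at each site is what a toppling of the root would send; by the burning test
each site then topples once and the state is restored. -/
theorem cellSettle_four : ∀ a b c : Fin 3, IsCellRecurrent ![(a : ℕ), b, c] →
    cellSettle 9 (a + 1) (b + 1) (c + 1) = (((a : ℕ), (b : ℕ), (c : ℕ)), 3) := by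
  decide +kernel

theorem cellRun_four {f : Fin 3 → ℕ} (hf : IsCellRecurrent f) (i : Fin 3) :
    CellRun (cellTopple i (f + Pi.single i 4)) 3 f := by
  obtain ⟨a, b, c, rfl⟩ := hf.exists_fin
  have h : cellTopple i (![(a : ℕ), b, c] + Pi.single i 4) = ![(a : ℕ) + 1, b + 1, c + 1] := by
    funext j
    fin_cases i <;> fin_cases j <;> simp [cellTopple]
  rw [h]
  have := cellRun_cellSettle 9 (a + 1) (b + 1) (c + 1)
  rwa [cellSettle_four a b c hf] at this

/-- The sandpile group of `K₄` is `(ℤ/4)²`, so four particles at one site restore the state and all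
four leave. Thus 0 and 4 are absorbing for the flow along the diagonal. -/
theorem cellOut_zero_four : ∀ a b c : Fin 3, IsCellRecurrent ![(a : ℕ), b, c] →
    cellOut 0 ![(a : ℕ), b, c] = 0 ∧ cellOut 4 ![(a : ℕ), b, c] = 4 := by
  decide +kernel

theorem cellOut_le : ∀ a b c : Fin 3, IsCellRecurrent ![(a : ℕ), b, c] →
    ∀ k : Fin 5, cellOut k ![(a : ℕ), b, c] ≤ 4 := by
  decide +kernel

/-- The recurrent sandpiles on a single cell. -/
abbrev CellState : Type := {f : Fin 3 → Fin 3 // IsCellRecurrent fun j => (f j : ℕ)}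

/-- The numbers of particles in a cell. -/
def CellState.val (s : CellState) : Fin 3 → ℕ := fun j => (s.1 j : ℕ)

theorem CellState.isCellRecurrent (s : CellState) : IsCellRecurrent s.val := s.2

theorem CellState.val_injective : Function.Injective CellState.val := by
  intro s t h
  apply Subtype.ext
  funext j
  exact Fin.ext (congrFun h j)

theorem IsCellRecurrent.exists_val {f : Fin 3 → ℕ} (h : IsCellRecurrent f) :
    ∃ s : CellState, s.val = f := ⟨⟨fun j => ⟨f j, h.1 j⟩, h⟩, rfl⟩

/-- This is the number of spanning trees of `K₄`. -/
theorem card_cellState : Fintype.card CellState = 16 := by decide +kernel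

theorem CellState.cellOut_zero (s : CellState) : cellOut 0 s.val = 0 :=
  (cellOut_zero_four (s.1 0) (s.1 1) (s.1 2) (by
    convert s.2 using 1; funext j; fin_cases j <;> rfl)).1

theorem CellState.cellOut_four (s : CellState) : cellOut 4 s.val = 4 :=
  (cellOut_zero_four (s.1 0) (s.1 1) (s.1 2) (by
    convert s.2 using 1; funext j; fin_cases j <;> rfl)).2

theorem CellState.cellOut_le (s : CellState) {k : ℕ} (hk : k ≤ 4) : cellOut k s.val ≤ 4 :=
  Sandpile.cellOut_le (s.1 0) (s.1 1) (s.1 2) (by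
    convert s.2 using 1; funext j; fin_cases j <;> rfl) ⟨k, by omega⟩

theorem isCellRecurrent_two : IsCellRecurrent fun _ => 2 := by decide +kernel

end CellComputation

/-! ### Stabilization cell by cell and the recurrent sandpiles -/

namespace CellStructure

variable {X : Type*} {G : SimpleGraph X} {W : Set X} {C : Type*} (S : CellStructure G W C)

/-- Each toppling in the cell is realized by toppling a whole branch, which sends exactly one
particle to the root; so `m` counts both topplings and arrivals. Only the lower cells have to be
recurrent, not `c` itself. -/
theorem exists_legalTopplings_cellRun [DecidableEq C] {κ : C → Fin 3 → ℕ} {c : C} {m : ℕ}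
    {f g : Fin 3 → ℕ} (h : CellRun f m g) (hf : κ c = f)
    (hg : ∀ c', S.height c' < S.height c → IsCellRecurrent (κ c')) :
    ∃ l, LegalTopplings G l (S.load κ) (S.load (Function.update κ c g) + S.atRoot c m) := by
  induction h generalizing κ with
  | refl f =>
    refine ⟨[], ?_⟩
    rw [← hf, Function.update_eq_self, S.atRoot_zero, add_zero]
    exact .nil _
  | @step f g m i h3 _ ih =>
    obtain ⟨l, hl, -⟩ := S.exists_legalTopplings_cellTopple (κ := κ) (c := c) (i := i)
      (by rw [hf]; exact h3) hg
    obtain ⟨l', hl'⟩ := ih (κ := Function.update κ c (cellTopple i (κ c)))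
      (by rw [Function.update_self, hf]) (fun c' hc' => by
        rw [Function.update_of_ne (by rintro rfl; omega)]
        exact hg c' hc')
    refine ⟨l ++ l', hl.append ?_⟩
    have := hl'.add (S.atRoot c 1)
    rwa [Function.update_idem, add_assoc, ← S.atRoot_add] at this

theorem load_add_particles [DecidableEq C] (κ : C → Fin 3 → ℕ) (c : C) (i : Fin 3) (k : ℕ) :
    S.load κ + k • particles [S.site (c, i)] =
      S.load (Function.update κ c (κ c + Pi.single i k)) := by
  classical
  funext v
  obtain ⟨⟨c', j⟩, rfl⟩ := S.site.surjective v
  rw [Pi.add_apply, S.load_site, S.load_site, particles_cons, particles_nil, add_zero,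
    Pi.smul_apply]
  by_cases hc : c' = c
  · subst hc
    rw [Function.update_self, Pi.add_apply]
    by_cases hj : j = i
    · subst hj
      simp
      ring
    · have : S.site (c', j) ≠ S.site (c', i) := by simpa using hj
      simp [hj, this]
  · have : S.site (c', j) ≠ S.site (c, i) := fun h => hc (by
      have := S.site.injective h
      exact congrArg Prod.fst this)
    simp [hc, this]

theorem atRoot_eq_particles {c c' : C} {i : Fin 3} (h : S.root c = S.site (c', i)) (k : ℕ) :
    S.atRoot c k = k • particles [S.site (c', i)] := by
  classical
  funext w
  rw [particles_cons, particles_nil, add_zero, Pi.smul_apply, atRoot, h]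
  by_cases hw : w = S.site (c', i)
  · subst hw
    simp
  · have : (w : X) ≠ S.site (c', i) := fun e => hw (Subtype.ext e)
    simp [hw, this]

/-- Four particles pass through a cell without changing it. -/
theorem exists_legalTopplings_four {κ : C → Fin 3 → ℕ} (hg : ∀ c, IsCellRecurrent (κ c))
    (c : C) (i : Fin 3) :
    ∃ l, LegalTopplings G l (S.load κ + 4 • particles [S.site (c, i)])
      (S.load κ + S.atRoot c 4) ∧ ∀ x, S.Desc x (S.site (c, i)) → x ∈ l := by
  classical
  rw [S.load_add_particles]
  set κ' := Function.update κ c (κ c + Pi.single i 4) with hκ'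
  have hκc : κ' c = κ c + Pi.single i 4 := Function.update_self _ _ _
  have hlow : ∀ c', S.height c' < S.height c → κ' c' = κ c' := fun c' hc' =>
    Function.update_of_ne (by rintro rfl; omega) _ _
  -- The toppling at `i` is split off because it is the one that is known to topple everything
  -- behind this site.
  obtain ⟨l, hl, hm⟩ := S.exists_legalTopplings_cellTopple (κ := κ') (c := c) (i := i)
    (by rw [hκc]; simp) (fun c' hc' => by rw [hlow c' hc']; exact hg c')
  obtain ⟨l', hl'⟩ := S.exists_legalTopplings_cellRun
    (κ := Function.update κ' c (cellTopple i (κ' c))) (c := c) (cellRun_four (hg c) i)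
    (by rw [Function.update_self, hκc]) (fun c' hc' => by
      rw [Function.update_of_ne (by rintro rfl; omega), hlow c' hc']
      exact hg c')
  refine ⟨l ++ l', hl.append ?_, fun x hx => List.mem_append_left _ (hm x hx)⟩
  have := hl'.add (S.atRoot c 1)
  have hu : Function.update (Function.update κ' c (cellTopple i (κ' c))) c (κ c) = κ := by
    rw [Function.update_idem, hκ', Function.update_idem, Function.update_eq_self]
  rwa [hu, add_assoc, ← S.atRoot_add] at this

/-- The four particles move from root to root and leave every cell as it was. Heights increase and
are bounded, so they finally drop out of `W`. -/
theorem exists_legalTopplings_add_four [Finite W] {κ : C → Fin 3 → ℕ}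
    (hg : ∀ c, IsCellRecurrent (κ c)) (v : W) :
    ∃ l, LegalTopplings G l (S.load κ + 4 • particles [v]) (S.load κ) := by
  classical
  obtain ⟨M, hM⟩ : ∃ M, ∀ w, S.height (S.cell w) ≤ M := by
    obtain ⟨M, hM⟩ := (Set.finite_range fun w => S.height (S.cell w)).bddAbove
    exact ⟨M, fun w => hM ⟨w, rfl⟩⟩
  induction hn : M - S.height (S.cell v) using Nat.strong_induction_on generalizing v with
  | _ n ih =>
    obtain ⟨⟨c, i⟩, rfl⟩ := S.site.surjective v
    obtain ⟨l, hl, -⟩ := S.exists_legalTopplings_four hg c i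
    by_cases hW : ∃ w : W, S.root c = w
    · obtain ⟨w, hw⟩ := hW
      have h1 := S.height_root hw
      have h2 := hM w
      rw [S.cell_site] at hn
      obtain ⟨l', hl'⟩ := ih _ (by omega) w rfl
      obtain ⟨⟨c', j⟩, rfl⟩ := S.site.surjective w
      rw [S.atRoot_eq_particles hw] at hl
      exact ⟨_, hl.append hl'⟩
    · have h0 : S.atRoot c 4 = (0 : W → ℕ) := by
        funext w
        exact if_neg fun h => hW ⟨w, h.symm⟩
      rw [h0, add_zero] at hl
      exact ⟨l, hl⟩

/-- The recurrent sandpiles are those that are recurrent in each cell. -/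
theorem recurrent_iff [Finite W] (σ : W → ℕ) :
    Recurrent G σ ↔ ∃ κ : C → CellState, S.load (fun c => (κ c).val) = σ := by
  rw [recurrent_iff_allowed]
  · constructor
    · rintro ⟨hs, ha⟩
      obtain ⟨κ, hκ, rfl⟩ := S.exists_load_eq hs ha
      choose s hs using fun c => (hκ c).exists_val
      exact ⟨s, congrArg S.load (funext hs)⟩
    · rintro ⟨κ, rfl⟩
      exact ⟨S.stable_load.2 fun c => (κ c).isCellRecurrent.1,
        S.allowed_load fun c => (κ c).isCellRecurrent⟩
  · intro v
    rw [S.deg_eq]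
    omega
  · convert S.allowed_load (κ := fun _ _ => 2) fun _ => isCellRecurrent_two using 1
    funext v
    simp only [load, S.deg_eq]
    omega
  · intro σ hs ha v
    obtain ⟨κ, hκ, rfl⟩ := S.exists_load_eq hs ha
    exact S.exists_legalTopplings_add_four hκ v

/-! ### The flow of particles along a path of cells to infinity -/

section Spine

/-- The numbers of particles that successively reach the roots of the cells `d 0, d 1, …` when one
particle is added in `d 0`. -/
def flow (s : ℕ → CellState) : ℕ → ℕ
  | 0 => 1
  | j + 1 => cellOut (flow s j) (s j).val

theorem flow_le (s : ℕ → CellState) (j : ℕ) : flow s j ≤ 4 := by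
  induction j with
  | zero => simp [flow]
  | succ j ih => exact (s j).cellOut_le ih

theorem flow_eq_four {s : ℕ → CellState} {i j : ℕ} (h : flow s i = 4) (hij : i ≤ j) :
    flow s j = 4 := by
  induction hij with
  | refl => exact h
  | step _ ih => rw [flow, ih, CellState.cellOut_four]

theorem flow_eq_zero {s : ℕ → CellState} {i j : ℕ} (h : flow s i = 0) (hij : i ≤ j) :
    flow s j = 0 := by
  induction hij with
  | refl => exact h
  | step _ ih => rw [flow, ih, CellState.cellOut_zero]

variable {d : ℕ → C} (hd : ∀ j, S.root (d j) = S.site (d (j + 1), 0)) (κ : C → CellState)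

include hd

theorem height_spine : StrictMono fun j => S.height (d j) :=
  strictMono_nat_of_lt_succ fun j => by
    have := S.height_root (hd j)
    rwa [S.cell_site] at this

/-- Cells already passed may have changed, but `d m` for `m ≥ j` is untouched, so the number of
particles it will emit depends on its original state only. -/
theorem exists_legalTopplings_flow (j : ℕ) :
    ∃ l, ∃ κ' : C → Fin 3 → ℕ, (∀ c, IsCellRecurrent (κ' c)) ∧
      (∀ m, j ≤ m → κ' (d m) = (κ (d m)).val) ∧
      LegalTopplings G l (S.load (fun c => (κ c).val) + particles [S.site (d 0, 0)])
        (S.load κ' + flow (fun j => κ (d j)) j • particles [S.site (d j, 0)]) := by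
  classical
  induction j with
  | zero =>
    refine ⟨[], fun c => (κ c).val, fun c => (κ c).isCellRecurrent, fun _ _ => rfl, ?_⟩
    rw [flow, one_smul]
    exact .nil _
  | succ j ih =>
    obtain ⟨l, κ', hκ', hm, hl⟩ := ih
    rw [S.load_add_particles] at hl
    obtain ⟨g, hg, hrun⟩ := exists_cellRun_cellOut (hκ' (d j)) (flow_le (fun j => κ (d j)) j)
    obtain ⟨l', hl'⟩ := S.exists_legalTopplings_cellRun hrun
      (κ := Function.update κ' (d j) (κ' (d j) + Pi.single 0 (flow (fun j => κ (d j)) j)))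
      (c := d j) (Function.update_self _ _ _) (fun c' hc' => by
        rw [Function.update_of_ne (by rintro rfl; omega)]
        exact hκ' c')
    rw [Function.update_idem, S.atRoot_eq_particles (hd j), hm j le_rfl] at hl'
    refine ⟨l ++ l', Function.update κ' (d j) g, fun c => ?_, fun m hjm => ?_, ?_⟩
    · by_cases hc : c = d j
      · subst hc
        rwa [Function.update_self]
      · rw [Function.update_of_ne hc]
        exact hκ' c
    · rw [Function.update_of_ne, hm m (by omega)]
      intro h
      have h1 := S.height_spine hd (show j < m by omega)
      simp only [h] at h1
      omega
    · rw [hm j le_rfl] at hl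
      exact hl.append hl'

theorem stabilizes_of_flow_eq_zero {j : ℕ} (h : flow (fun j => κ (d j)) j = 0) :
    Stabilizes G (S.load (fun c => (κ c).val) + particles [S.site (d 0, 0)]) := by
  obtain ⟨l, κ', hκ', -, hl⟩ := S.exists_legalTopplings_flow hd κ j
  rw [h, zero_smul, add_zero] at hl
  exact ⟨_, ⟨l, hl⟩, S.stable_load.2 fun c => (hκ' c).1⟩

/-- Four particles pass through each further cell without changing it and topple all that lies
behind its entrance. From some cell on, this includes `v`, so `v` topples once more in each step. -/
theorem explodes_of_flow_eq_four (hdesc : ∀ v, ∃ j, S.Desc v (S.site (d j, 0))) {j : ℕ}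
    (h : flow (fun j => κ (d j)) j = 4) :
    Explodes G (S.load (fun c => (κ c).val) + particles [S.site (d 0, 0)]) := by
  classical
  intro v N
  obtain ⟨i, hi⟩ := hdesc v
  have hdm : ∀ m, i ≤ m → S.Desc v (S.site (d m, 0)) := by
    intro m him
    induction him with
    | refl => exact hi
    | @step m _ ih => exact ih.tail (by rw [S.cell_site]; exact hd m)
  obtain ⟨l, κ', hκ', -, hl⟩ := S.exists_legalTopplings_flow hd κ (max i j)
  rw [flow_eq_four h (le_max_right _ _)] at hl
  have key : ∀ N, ∃ l, LegalTopplings G l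
      (S.load κ' + 4 • particles [S.site (d (max i j), 0)])
      (S.load κ' + 4 • particles [S.site (d (max i j + N), 0)]) ∧ N ≤ l.count v := by
    intro N
    induction N with
    | zero => exact ⟨[], .nil _, Nat.zero_le _⟩
    | succ N ih =>
      obtain ⟨l, hl, hc⟩ := ih
      obtain ⟨l', hl', hm⟩ := S.exists_legalTopplings_four hκ' (d (max i j + N)) 0
      rw [S.atRoot_eq_particles (hd _)] at hl'
      refine ⟨l ++ l', hl.append hl', ?_⟩
      have h1 := List.one_le_count_iff.2 (hm v (hdm _ ((le_max_left i j).trans (Nat.le_add_right _ _))))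
      rw [List.count_append]
      omega
  obtain ⟨l', hl', hc⟩ := key N
  refine ⟨l ++ l', _, hl.append hl', ?_⟩
  have h1 : N ≤ (l ++ l').count v := by
    rw [List.count_append]
    omega
  convert h1

end Spine

end CellStructure

end Sandpile

namespace Vicsek

/-! ### Cells, roots and heights in terms of base 3 digits -/

section Digits

/-- `(x, y)` is the lower left corner of a cell of the infinite Vicsek graph. -/
def IsCell (x y : ℕ) : Prop := ∀ i, x / 3 ^ i % 3 = 1 ↔ y / 3 ^ i % 3 = 1

/-- Splitting off the lowest digits views the graph as a coarser copy with each cell refined into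
five; `isCell_add` splits off the highest digits, as in the recursion for `vertices`. -/
theorem isCell_step (x y : ℕ) {a b : ℕ} (ha : a < 3) (hb : b < 3) :
    IsCell (3 * x + a) (3 * y + b) ↔ (a = 1 ↔ b = 1) ∧ IsCell x y := by
  have h : ∀ z c i : ℕ, c < 3 → (3 * z + c) / 3 ^ (i + 1) = z / 3 ^ i := by
    intro z c i hc
    rw [pow_succ', ← Nat.div_div_eq_div_mul]
    congr 1
    omega
  constructor
  · intro hc
    refine ⟨?_, fun i => ?_⟩
    · have := hc 0
      simp only [pow_zero, Nat.div_one] at this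
      omega
    · have := hc (i + 1)
      rwa [h _ _ _ ha, h _ _ _ hb] at this
  · rintro ⟨h0, hc⟩ i
    cases i with
    | zero =>
      simp only [pow_zero, Nat.div_one]
      omega
    | succ i =>
      rw [h _ _ _ ha, h _ _ _ hb]
      exact hc i

theorem isCell_self (x : ℕ) : IsCell x x := fun _ => Iff.rfl

/-- Corresponding digits have equal parity and 3 is odd. Consequently two cells never share a side;
distinct cells can meet only diagonally, in a corner. -/
theorem IsCell.mod_two {x y : ℕ} (h : IsCell x y) : x % 2 = y % 2 := by
  induction hn : x + y using Nat.strong_induction_on generalizing x y with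
  | _ n ih =>
    by_cases h0 : n = 0
    · omega
    · rw [← Nat.div_add_mod x 3, ← Nat.div_add_mod y 3,
        isCell_step _ _ (Nat.mod_lt _ (by norm_num)) (Nat.mod_lt _ (by norm_num))] at h
      have := ih (x / 3 + y / 3) (by omega) h.2 rfl
      omega

theorem isCell_add {n x y a b : ℕ} (hx : x < 3 ^ n) (hy : y < 3 ^ n) (ha : a < 3) (hb : b < 3) :
    IsCell (a * 3 ^ n + x) (b * 3 ^ n + y) ↔ (a = 1 ↔ b = 1) ∧ IsCell x y := by
  induction n generalizing x y with
  | zero =>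
    obtain rfl : x = 0 := by simpa using hx
    obtain rfl : y = 0 := by simpa using hy
    have := isCell_step 0 0 ha hb
    simpa using this
  | succ n ih =>
    have h : ∀ z c : ℕ, c * 3 ^ (n + 1) + z = 3 * (c * 3 ^ n + z / 3) + z % 3 := by
      intro z c
      have := Nat.div_add_mod z 3
      rw [pow_succ]
      linarith
    have hm : ∀ z : ℕ, z % 3 < 3 := fun z => Nat.mod_lt _ (by norm_num)
    rw [pow_succ] at hx hy
    rw [h, h, isCell_step _ _ (hm x) (hm y), ih (by omega) (by omega)]
    conv_rhs => rw [← Nat.div_add_mod x 3, ← Nat.div_add_mod y 3, isCell_step _ _ (hm x) (hm y)]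
    tauto

/-- The corner of a cell that is its root, in terms of the last digits and of the root of the
enclosing larger cell. -/
def turn (a b : ℕ) (q : Bool × Bool) : Bool × Bool :=
  if a = 1 then q
  else if (decide (a = 2), decide (b = 2)) = q then q else (!decide (a = 2), !decide (b = 2))

/-- The last digit of the height of a cell. -/
def rank (a b : ℕ) (q : Bool × Bool) : ℕ :=
  if a = 1 then 1 else if (decide (a = 2), decide (b = 2)) = q then 2 else 0

/-- The corner of a cell through which paths to infinity leave it. -/
def dir (x y : ℕ) : Bool × Bool :=
  if x = 0 ∧ y = 0 then (true, true) else turn (x % 3) (y % 3) (dir (x / 3) (y / 3))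
termination_by x + y

/-- A height function on cells that increases along paths to infinity. -/
def height (x y : ℕ) : ℕ :=
  if x = 0 ∧ y = 0 then 0
  else 3 * height (x / 3) (y / 3) + rank (x % 3) (y % 3) (dir (x / 3) (y / 3))
termination_by x + y

theorem dir_zero : dir 0 0 = (true, true) := by
  rw [dir]
  simp

/-- The value at the origin is fixed by `turn 0 0`, so the recursion has no exceptional case. -/
theorem dir_step (x y : ℕ) {a b : ℕ} (ha : a < 3) (hb : b < 3) :
    dir (3 * x + a) (3 * y + b) = turn a b (dir x y) := by
  by_cases h : 3 * x + a = 0 ∧ 3 * y + b = 0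
  · obtain ⟨rfl, rfl, rfl, rfl⟩ : x = 0 ∧ a = 0 ∧ y = 0 ∧ b = 0 := by omega
    rw [Nat.mul_zero, Nat.zero_add, dir_zero]
    rfl
  · rw [dir, if_neg h]
    congr 2 <;> omega

theorem height_step (x y : ℕ) {a b : ℕ} (ha : a < 3) (hb : b < 3) :
    height (3 * x + a) (3 * y + b) = 3 * height x y + rank a b (dir x y) := by
  by_cases h : 3 * x + a = 0 ∧ 3 * y + b = 0
  · obtain ⟨rfl, rfl, rfl, rfl⟩ : x = 0 ∧ a = 0 ∧ y = 0 ∧ b = 0 := by omega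
    rw [Nat.mul_zero, Nat.zero_add, dir_zero, height]
    rfl
  · rw [height, if_neg h]
    congr 2
    · congr 1 <;> omega
    · omega
    · omega
    · congr 1 <;> omega

theorem dir_self (x : ℕ) : dir x x = (true, true) := by
  induction x using Nat.strong_induction_on with
  | _ x ih =>
    by_cases h : x = 0
    · rw [h, dir_zero]
    · have hx := Nat.div_add_mod x 3
      rw [← hx, dir_step _ _ (Nat.mod_lt _ (by norm_num)) (Nat.mod_lt _ (by norm_num)),
        ih (x / 3) (by omega)]
      have : x % 3 = 0 ∨ x % 3 = 1 ∨ x % 3 = 2 := by omega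
      rcases this with h | h | h <;> rw [h] <;> rfl

/-- The possible situations at a vertex that is the corner `e` of one square and the corner `e'` of
the opposite one: it is the root of exactly one of them if both are cells, and not the root if only
one of them is a cell. -/
def Across (c c' : Prop) (q q' e e' : Bool × Bool) (h h' : ℕ) : Prop :=
  (c → c' → (q = e ∧ q' ≠ e' ∧ h < h') ∨ (q ≠ e ∧ q' = e' ∧ h' < h)) ∧
    (c → ¬ c' → q ≠ e) ∧ (¬ c → c' → q' ≠ e')

/-- Compare lowest digits. Without carry both squares lie in one larger square and finitely many
cases remain. A carry in one coordinate leaves at most one cell, with its root on the other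
diagonal. Two carries reduce the claim to the larger squares. -/
theorem across_diagonal (x y : ℕ) : Across (IsCell x y) (IsCell (x + 1) (y + 1)) (dir x y)
    (dir (x + 1) (y + 1)) (true, true) (false, false) (height x y) (height (x + 1) (y + 1)) := by
  induction x using Nat.strong_induction_on generalizing y with
  | _ x ih =>
    obtain ⟨X, i, hi, rfl⟩ : ∃ X i, i < 3 ∧ x = 3 * X + i :=
      ⟨x / 3, x % 3, Nat.mod_lt _ (by norm_num), (Nat.div_add_mod x 3).symm⟩
    obtain ⟨Y, j, hj, rfl⟩ : ∃ Y j, j < 3 ∧ y = 3 * Y + j :=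
      ⟨y / 3, y % 3, Nat.mod_lt _ (by norm_num), (Nat.div_add_mod y 3).symm⟩
    have step : ∀ X' Y' i' j' : ℕ, i' < 3 → j' < 3 → 3 * X + i + 1 = 3 * X' + i' →
        3 * Y + j + 1 = 3 * Y' + j' →
        Across ((i = 1 ↔ j = 1) ∧ IsCell X Y) ((i' = 1 ↔ j' = 1) ∧ IsCell X' Y')
          (turn i j (dir X Y)) (turn i' j' (dir X' Y')) (true, true) (false, false)
          (3 * height X Y + rank i j (dir X Y)) (3 * height X' Y' + rank i' j' (dir X' Y')) →
        Across (IsCell (3 * X + i) (3 * Y + j)) (IsCell (3 * X + i + 1) (3 * Y + j + 1))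
          (dir (3 * X + i) (3 * Y + j)) (dir (3 * X + i + 1) (3 * Y + j + 1)) (true, true)
          (false, false) (height (3 * X + i) (3 * Y + j))
          (height (3 * X + i + 1) (3 * Y + j + 1)) := by
      intro X' Y' i' j' hi' hj' hx hy h
      rwa [hx, hy, isCell_step _ _ hi hj, isCell_step _ _ hi' hj', dir_step _ _ hi hj,
        dir_step _ _ hi' hj', height_step _ _ hi hj, height_step _ _ hi' hj']
    rcases Nat.lt_or_ge i 2 with hi2 | hi2
    · rcases Nat.lt_or_ge j 2 with hj2 | hj2
      · refine step X Y (i + 1) (j + 1) (by omega) (by omega) (by omega) (by omega) ?_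
        generalize dir X Y = q
        obtain ⟨q1, q2⟩ := q
        interval_cases i <;> interval_cases j <;> cases q1 <;> cases q2 <;>
          simp [Across, turn, rank]
      · obtain rfl : j = 2 := by omega
        refine step X (Y + 1) (i + 1) 0 (by omega) (by omega) (by omega) (by omega) ?_
        generalize dir X Y = q
        generalize dir X (Y + 1) = q'
        obtain ⟨q1, q2⟩ := q
        obtain ⟨q1', q2'⟩ := q'
        interval_cases i <;> cases q1 <;> cases q2 <;> cases q1' <;> cases q2' <;>
          simp [Across, turn, rank]
    · obtain rfl : i = 2 := by omega
      rcases Nat.lt_or_ge j 2 with hj2 | hj2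
      · refine step (X + 1) Y 0 (j + 1) (by omega) (by omega) (by omega) (by omega) ?_
        generalize dir X Y = q
        generalize dir (X + 1) Y = q'
        obtain ⟨q1, q2⟩ := q
        obtain ⟨q1', q2'⟩ := q'
        interval_cases j <;> cases q1 <;> cases q2 <;> cases q1' <;> cases q2' <;>
          simp [Across, turn, rank]
      · obtain rfl : j = 2 := by omega
        refine step (X + 1) (Y + 1) 0 0 (by omega) (by omega) (by omega) (by omega) ?_
        have h := ih X (by omega) Y
        revert h
        generalize dir X Y = q
        generalize dir (X + 1) (Y + 1) = q'
        generalize height X Y = m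
        generalize height (X + 1) (Y + 1) = m'
        obtain ⟨q1, q2⟩ := q
        obtain ⟨q1', q2'⟩ := q'
        cases q1 <;> cases q2 <;> cases q1' <;> cases q2' <;>
          simp [Across, turn, rank] <;> grind

theorem across_antidiagonal (x y : ℕ) : Across (IsCell x (y + 1)) (IsCell (x + 1) y)
    (dir x (y + 1)) (dir (x + 1) y) (true, false) (false, true) (height x (y + 1))
    (height (x + 1) y) := by
  induction x using Nat.strong_induction_on generalizing y with
  | _ x ih =>
    obtain ⟨X, i, hi, rfl⟩ : ∃ X i, i < 3 ∧ x = 3 * X + i :=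
      ⟨x / 3, x % 3, Nat.mod_lt _ (by norm_num), (Nat.div_add_mod x 3).symm⟩
    obtain ⟨Y, j, hj, rfl⟩ : ∃ Y j, j < 3 ∧ y = 3 * Y + j :=
      ⟨y / 3, y % 3, Nat.mod_lt _ (by norm_num), (Nat.div_add_mod y 3).symm⟩
    have step : ∀ X' Y' i' j' : ℕ, i' < 3 → j' < 3 → 3 * X + i + 1 = 3 * X' + i' →
        3 * Y + j + 1 = 3 * Y' + j' →
        Across ((i = 1 ↔ j' = 1) ∧ IsCell X Y') ((i' = 1 ↔ j = 1) ∧ IsCell X' Y)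
          (turn i j' (dir X Y')) (turn i' j (dir X' Y)) (true, false) (false, true)
          (3 * height X Y' + rank i j' (dir X Y')) (3 * height X' Y + rank i' j (dir X' Y)) →
        Across (IsCell (3 * X + i) (3 * Y + j + 1)) (IsCell (3 * X + i + 1) (3 * Y + j))
          (dir (3 * X + i) (3 * Y + j + 1)) (dir (3 * X + i + 1) (3 * Y + j)) (true, false)
          (false, true) (height (3 * X + i) (3 * Y + j + 1))
          (height (3 * X + i + 1) (3 * Y + j)) := by
      intro X' Y' i' j' hi' hj' hx hy h
      rwa [hx, hy, isCell_step _ _ hi hj', isCell_step _ _ hi' hj, dir_step _ _ hi hj',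
        dir_step _ _ hi' hj, height_step _ _ hi hj', height_step _ _ hi' hj]
    rcases Nat.lt_or_ge i 2 with hi2 | hi2
    · rcases Nat.lt_or_ge j 2 with hj2 | hj2
      · refine step X Y (i + 1) (j + 1) (by omega) (by omega) (by omega) (by omega) ?_
        generalize dir X Y = q
        obtain ⟨q1, q2⟩ := q
        interval_cases i <;> interval_cases j <;> cases q1 <;> cases q2 <;>
          simp [Across, turn, rank]
      · obtain rfl : j = 2 := by omega
        refine step X (Y + 1) (i + 1) 0 (by omega) (by omega) (by omega) (by omega) ?_
        generalize dir X Y = q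
        generalize dir X (Y + 1) = q'
        obtain ⟨q1, q2⟩ := q
        obtain ⟨q1', q2'⟩ := q'
        interval_cases i <;> cases q1 <;> cases q2 <;> cases q1' <;> cases q2' <;>
          simp [Across, turn, rank]
    · obtain rfl : i = 2 := by omega
      rcases Nat.lt_or_ge j 2 with hj2 | hj2
      · refine step (X + 1) Y 0 (j + 1) (by omega) (by omega) (by omega) (by omega) ?_
        generalize dir X Y = q
        generalize dir (X + 1) Y = q'
        obtain ⟨q1, q2⟩ := q
        obtain ⟨q1', q2'⟩ := q'
        interval_cases j <;> cases q1 <;> cases q2 <;> cases q1' <;> cases q2' <;>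
          simp [Across, turn, rank]
      · obtain rfl : j = 2 := by omega
        refine step (X + 1) (Y + 1) 0 0 (by omega) (by omega) (by omega) (by omega) ?_
        have h := ih X (by omega) Y
        revert h
        generalize dir X (Y + 1) = q
        generalize dir (X + 1) Y = q'
        generalize height X (Y + 1) = m
        generalize height (X + 1) Y = m'
        obtain ⟨q1, q2⟩ := q
        obtain ⟨q1', q2'⟩ := q'
        cases q1 <;> cases q2 <;> cases q1' <;> cases q2' <;>
          simp [Across, turn, rank] <;> grind

/-- A left subcell is never the exit of a larger cell that is left on the right, so it turns towards
the centre, again to the right. Hence no root lies beyond the edge of the quadrant. -/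
theorem dir_zero_left {y : ℕ} (h : IsCell 0 y) : (dir 0 y).1 = true := by
  induction y using Nat.strong_induction_on with
  | _ y ih =>
    by_cases hy : y = 0
    · rw [hy, dir_zero]
    · have hm : y % 3 < 3 := Nat.mod_lt _ (by norm_num)
      have e : dir 0 y = dir (3 * 0 + 0) (3 * (y / 3) + y % 3) := by
        rw [Nat.div_add_mod]
      have h' : IsCell (3 * 0 + 0) (3 * (y / 3) + y % 3) := by
        rwa [Nat.div_add_mod]
      rw [isCell_step _ _ (by norm_num) hm] at h'
      have := ih (y / 3) (by omega) h'.2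
      rw [e, dir_step _ _ (by norm_num) hm]
      revert this
      generalize dir 0 (y / 3) = q
      obtain ⟨q1, q2⟩ := q
      intro hq
      simp only at hq
      subst hq
      simp [turn]

theorem dir_zero_right {x : ℕ} (h : IsCell x 0) : (dir x 0).2 = true := by
  induction x using Nat.strong_induction_on with
  | _ x ih =>
    by_cases hx : x = 0
    · rw [hx, dir_zero]
    · have hm : x % 3 < 3 := Nat.mod_lt _ (by norm_num)
      have e : dir x 0 = dir (3 * (x / 3) + x % 3) (3 * 0 + 0) := by
        rw [Nat.div_add_mod]
      have h' : IsCell (3 * (x / 3) + x % 3) (3 * 0 + 0) := by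
        rwa [Nat.div_add_mod]
      rw [isCell_step _ _ hm (by norm_num)] at h'
      have := ih (x / 3) (by omega) h'.2
      rw [e, dir_step _ _ hm (by norm_num)]
      revert this
      generalize dir (x / 3) 0 = q
      obtain ⟨q1, q2⟩ := q
      intro hq
      simp only at hq
      subst hq
      have h1 := h'.1
      simp only [turn]
      split_ifs <;> simp_all

end Digits

/-! ### Every vertex is a site of exactly one cell -/

section Corners

/-- The four vertices of a cell. -/
def corner (c : ℕ × ℕ) (e : Bool × Bool) : ℕ × ℕ := (c.1 + e.1.toNat, c.2 + e.2.toNat)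

/-- The three corners of a cell other than its root, beginning with the one opposite to it. -/
def label : Fin 3 → Bool × Bool → Bool × Bool
  | 0, q => (!q.1, !q.2)
  | 1, q => (!q.1, q.2)
  | 2, q => (q.1, !q.2)

theorem label_ne : ∀ (i : Fin 3) (q : Bool × Bool), label i q ≠ q := by decide

theorem exists_label : ∀ e q : Bool × Bool, e ≠ q → ∃ i, label i q = e := by decide

theorem label_injective : ∀ (q : Bool × Bool) (i j : Fin 3), label i q = label j q → i = j := by
  decide

/-- The root of a cell. -/
def cellRoot (c : ℕ × ℕ) : ℕ × ℕ := corner c (dir c.1 c.2)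

/-- The vertices of a cell other than its root. -/
def cellSite (c : ℕ × ℕ) (i : Fin 3) : ℕ × ℕ := corner c (label i (dir c.1 c.2))

/-- By parity, distinct cells with a common vertex are diagonal neighbours, and the two `Across`
lemmas decide for which of them the vertex is the root. -/
theorem corner_eq_corner {c c' : ℕ × ℕ} (hc : IsCell c.1 c.2) (hc' : IsCell c'.1 c'.2)
    {e e' : Bool × Bool} (h : corner c e = corner c' e') :
    (c = c' ∧ e = e') ∨
      (dir c.1 c.2 = e ∧ dir c'.1 c'.2 ≠ e' ∧ height c.1 c.2 < height c'.1 c'.2) ∨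
      (dir c.1 c.2 ≠ e ∧ dir c'.1 c'.2 = e' ∧ height c'.1 c'.2 < height c.1 c.2) := by
  obtain ⟨x, y⟩ := c
  obtain ⟨x', y'⟩ := c'
  obtain ⟨e1, e2⟩ := e
  obtain ⟨e1', e2'⟩ := e'
  simp only at hc hc' ⊢
  have h1 := hc.mod_two
  have h2 := hc'.mod_two
  simp only [corner, Prod.mk.injEq] at h
  cases e1 <;> cases e2 <;> cases e1' <;> cases e2' <;>
    simp only [Bool.toNat_true, Bool.toNat_false] at h <;>
    first
    | (left; simp only [Prod.mk.injEq, and_true]; omega)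
    | omega
    | skip
  · obtain ⟨rfl, rfl⟩ : x = x' + 1 ∧ y = y' + 1 := by omega
    have := (across_diagonal x' y').1 hc' hc
    tauto
  · obtain ⟨rfl, rfl⟩ : x = x' + 1 ∧ y' = y + 1 := by omega
    have := (across_antidiagonal x' y).1 hc' hc
    tauto
  · obtain ⟨rfl, rfl⟩ : x' = x + 1 ∧ y = y' + 1 := by omega
    have := (across_antidiagonal x y').1 hc hc'
    tauto
  · obtain ⟨rfl, rfl⟩ : x' = x + 1 ∧ y' = y + 1 := by omega
    have := (across_diagonal x y).1 hc hc'
    tauto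

theorem cellSite_injective {c c' : ℕ × ℕ} (hc : IsCell c.1 c.2) (hc' : IsCell c'.1 c'.2)
    {i i' : Fin 3} (h : cellSite c i = cellSite c' i') : c = c' ∧ i = i' := by
  rcases corner_eq_corner hc hc' h with ⟨rfl, h⟩ | h | h
  · exact ⟨rfl, label_injective _ _ _ h⟩
  · exact absurd h.1.symm (label_ne _ _)
  · exact absurd h.2.1.symm (label_ne _ _)

theorem height_lt_of_cellSite_eq {c c' : ℕ × ℕ} (hc : IsCell c.1 c.2) (hc' : IsCell c'.1 c'.2)
    {i : Fin 3} (h : cellSite c' i = cellRoot c) : height c.1 c.2 < height c'.1 c'.2 := by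
  rcases corner_eq_corner hc hc' h.symm with ⟨rfl, h⟩ | h | h
  · exact absurd h.symm (label_ne _ _)
  · exact h.2.2
  · exact absurd rfl h.1

/-- If the corner is the root of `c`, the `Across` lemmas force the diagonally opposite square to be
a cell, of which this vertex is not the root. That square exists by `dir_zero_left` and
`dir_zero_right`. -/
theorem exists_cellSite_eq {c : ℕ × ℕ} (hc : IsCell c.1 c.2) (e : Bool × Bool) :
    ∃ c' : ℕ × ℕ, IsCell c'.1 c'.2 ∧ ∃ i, cellSite c' i = corner c e := by
  have key : ∀ (c' : ℕ × ℕ) (e' : Bool × Bool), IsCell c'.1 c'.2 → e' ≠ dir c'.1 c'.2 →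
      corner c' e' = corner c e →
      ∃ c' : ℕ × ℕ, IsCell c'.1 c'.2 ∧ ∃ i, cellSite c' i = corner c e := by
    intro c' e' h1 h2 h3
    obtain ⟨i, hi⟩ := exists_label _ _ h2
    exact ⟨c', h1, i, by rw [cellSite, hi, h3]⟩
  by_cases he : e = dir c.1 c.2
  swap
  · exact key c e hc he rfl
  obtain ⟨x, y⟩ := c
  obtain ⟨e1, e2⟩ := e
  simp only at hc he
  cases e1 <;> cases e2
  · have hx : x ≠ 0 := by
      rintro rfl
      have := dir_zero_left hc
      simp [← he] at this
    have hy : y ≠ 0 := by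
      rintro rfl
      have := dir_zero_right hc
      simp [← he] at this
    obtain ⟨x, rfl⟩ := Nat.exists_eq_succ_of_ne_zero hx
    obtain ⟨y, rfl⟩ := Nat.exists_eq_succ_of_ne_zero hy
    obtain ⟨a1, a2, a3⟩ := across_diagonal x y
    have hc' : IsCell x y := by
      by_contra h
      exact a3 h hc he.symm
    refine key (x, y) (true, true) hc' ?_ rfl
    have := a1 hc' hc
    simp only
    grind
  · have hx : x ≠ 0 := by
      rintro rfl
      have := dir_zero_left hc
      simp [← he] at this
    obtain ⟨x, rfl⟩ := Nat.exists_eq_succ_of_ne_zero hx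
    obtain ⟨a1, a2, a3⟩ := across_antidiagonal x y
    have hc' : IsCell x (y + 1) := by
      by_contra h
      exact a3 h hc he.symm
    refine key (x, y + 1) (true, false) hc' ?_ rfl
    have := a1 hc' hc
    simp only
    grind
  · have hy : y ≠ 0 := by
      rintro rfl
      have := dir_zero_right hc
      simp [← he] at this
    obtain ⟨y, rfl⟩ := Nat.exists_eq_succ_of_ne_zero hy
    obtain ⟨a1, a2, a3⟩ := across_antidiagonal x y
    have hc' : IsCell (x + 1) y := by
      by_contra h
      exact a2 hc h he.symm
    refine key (x + 1, y) (false, true) hc' ?_ rfl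
    have := a1 hc hc'
    simp only
    grind
  · obtain ⟨a1, a2, a3⟩ := across_diagonal x y
    have hc' : IsCell (x + 1) (y + 1) := by
      by_contra h
      exact a2 hc h he.symm
    refine key (x + 1, y + 1) (false, false) hc' ?_ rfl
    have := a1 hc hc'
    simp only
    grind

end Corners

end Vicsek

namespace Vicsek

/-! ### Vertices and edges of each level in terms of cells -/

section Levels

/-- The lower left corners of the cells of the `n`-level Vicsek graph. -/
def cells (n : ℕ) : Set (ℕ × ℕ) := {c | IsCell c.1 c.2 ∧ c.1 < 3 ^ n ∧ c.2 < 3 ^ n}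

/-- The lower left corners of the cells of the infinite Vicsek graph. -/
def allCells : Set (ℕ × ℕ) := {c | IsCell c.1 c.2}

theorem cells_subset_allCells (n : ℕ) : cells n ⊆ allCells := fun _ h => h.1

theorem cells_finite (n : ℕ) : (cells n).Finite :=
  ((Set.finite_Iio (3 ^ n)).prod (Set.finite_Iio (3 ^ n))).subset fun _ h => ⟨h.2.1, h.2.2⟩

theorem shift_corner (a c : ℕ × ℕ) (e : Bool × Bool) :
    shift a (corner c e) = corner (a + c) e := by
  simp only [shift, addLeftEmbedding_apply, corner, Prod.fst_add, Prod.snd_add]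
  ext <;> simp only [Prod.fst_add, Prod.snd_add] <;> omega

theorem add_mem_cells_succ {n a b : ℕ} (ha : a < 3) (hb : b < 3) (hab : a = 1 ↔ b = 1)
    {c : ℕ × ℕ} (hc : c ∈ cells n) : (a * 3 ^ n, b * 3 ^ n) + c ∈ cells (n + 1) := by
  obtain ⟨h1, h2, h3⟩ := hc
  refine ⟨(isCell_add h2 h3 ha hb).2 ⟨hab, h1⟩, ?_, ?_⟩
  · have : a * 3 ^ n ≤ 2 * 3 ^ n := Nat.mul_le_mul_right _ (by omega)
    simp only [Prod.fst_add, pow_succ]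
    omega
  · have : b * 3 ^ n ≤ 2 * 3 ^ n := Nat.mul_le_mul_right _ (by omega)
    simp only [Prod.snd_add, pow_succ]
    omega

theorem mem_cells_succ {n : ℕ} {c : ℕ × ℕ} : c ∈ cells (n + 1) ↔
    ∃ a ∈ ({0, (3 ^ n, 3 ^ n), (2 * 3 ^ n, 0), (0, 2 * 3 ^ n), (2 * 3 ^ n, 2 * 3 ^ n)} :
      Set (ℕ × ℕ)), ∃ c' ∈ cells n, c = a + c' := by
  constructor
  · rintro ⟨h1, h2, h3⟩
    have hp : 0 < 3 ^ n := by positivity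
    have hx := Nat.div_add_mod' c.1 (3 ^ n)
    have hy := Nat.div_add_mod' c.2 (3 ^ n)
    have hxm := Nat.mod_lt c.1 hp
    have hym := Nat.mod_lt c.2 hp
    have ha : c.1 / 3 ^ n < 3 := by
      rw [Nat.div_lt_iff_lt_mul hp]
      rwa [pow_succ, mul_comm] at h2
    have hb : c.2 / 3 ^ n < 3 := by
      rw [Nat.div_lt_iff_lt_mul hp]
      rwa [pow_succ, mul_comm] at h3
    rw [← hx, ← hy, isCell_add hxm hym ha hb] at h1
    refine ⟨(c.1 / 3 ^ n * 3 ^ n, c.2 / 3 ^ n * 3 ^ n), ?_, (c.1 % 3 ^ n, c.2 % 3 ^ n),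
      ⟨h1.2, hxm, hym⟩, Prod.ext hx.symm hy.symm⟩
    obtain ⟨hab, -⟩ := h1
    generalize c.1 / 3 ^ n = a at ha hab
    generalize c.2 / 3 ^ n = b at hb hab
    interval_cases a <;> interval_cases b <;> simp at hab ⊢
  · rintro ⟨a, ha, c', hc', rfl⟩
    rcases ha with rfl | rfl | rfl | rfl | rfl
    · have := add_mem_cells_succ (a := 0) (b := 0) (by norm_num) (by norm_num) (by norm_num) hc'
      simpa [Prod.mk_zero_zero] using this
    · have := add_mem_cells_succ (a := 1) (b := 1) (by norm_num) (by norm_num) (by norm_num) hc'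
      simpa using this
    · have := add_mem_cells_succ (a := 2) (b := 0) (by norm_num) (by norm_num) (by norm_num) hc'
      simpa using this
    · have := add_mem_cells_succ (a := 0) (b := 2) (by norm_num) (by norm_num) (by norm_num) hc'
      simpa using this
    · exact add_mem_cells_succ (a := 2) (b := 2) (by norm_num) (by norm_num) (by norm_num) hc'

theorem cells_zero : cells 0 = {(0, 0)} := by
  ext ⟨x, y⟩
  simp only [cells, pow_zero, Nat.lt_one_iff, Set.mem_ofPred_eq, Set.mem_singleton_iff,
    Prod.mk.injEq]
  constructor
  · exact fun h => h.2
  · rintro ⟨rfl, rfl⟩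
    exact ⟨isCell_self 0, rfl, rfl⟩

theorem mem_vertices {n : ℕ} {v : ℕ × ℕ} :
    v ∈ vertices n ↔ ∃ c ∈ cells n, ∃ e, corner c e = v := by
  induction n generalizing v with
  | zero =>
    rw [cells_zero]
    simp only [vertices, Set.mem_insert_iff, Set.mem_singleton_iff, exists_eq_left, Prod.exists,
      Bool.exists_bool, corner, Bool.toNat_true, Bool.toNat_false]
    grind
  | succ n ih =>
    simp only [vertices, Set.mem_union, Set.mem_image, ih, mem_cells_succ]
    constructor
    · rintro ((((⟨c, hc, e, rfl⟩ | ⟨_, ⟨c, hc, e, rfl⟩, rfl⟩) | ⟨_, ⟨c, hc, e, rfl⟩, rfl⟩) |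
        ⟨_, ⟨c, hc, e, rfl⟩, rfl⟩) | ⟨_, ⟨c, hc, e, rfl⟩, rfl⟩)
      · exact ⟨c, ⟨0, by simp, c, hc, by simp⟩, e, rfl⟩
      all_goals exact ⟨_, ⟨_, by simp, c, hc, rfl⟩, e, (shift_corner _ _ _).symm⟩
    · rintro ⟨_, ⟨a, ha, c, hc, rfl⟩, e, rfl⟩
      rcases ha with rfl | rfl | rfl | rfl | rfl
      · rw [zero_add]
        exact .inl (.inl (.inl (.inl ⟨c, hc, e, rfl⟩)))
      · exact .inl (.inl (.inl (.inr ⟨_, ⟨c, hc, e, rfl⟩, shift_corner _ _ _⟩)))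
      · exact .inl (.inl (.inr ⟨_, ⟨c, hc, e, rfl⟩, shift_corner _ _ _⟩))
      · exact .inl (.inr ⟨_, ⟨c, hc, e, rfl⟩, shift_corner _ _ _⟩)
      · exact .inr ⟨_, ⟨c, hc, e, rfl⟩, shift_corner _ _ _⟩

theorem graph_adj {n : ℕ} {v w : ℕ × ℕ} : (graph n).Adj v w ↔
    v ≠ w ∧ ∃ c ∈ cells n, (∃ e, corner c e = v) ∧ ∃ e, corner c e = w := by
  induction n generalizing v w with
  | zero =>
    have h : ∀ v, v ∈ vertices 0 ↔ ∃ e, corner (0, 0) e = v := fun v => by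
      rw [mem_vertices, cells_zero]
      simp
    simp only [graph, SimpleGraph.fromRel_adj, h, cells_zero, Set.mem_singleton_iff,
      exists_eq_left]
    tauto
  | succ n ih =>
    simp only [graph, SimpleGraph.sup_adj, SimpleGraph.map_adj, ih, mem_cells_succ]
    constructor
    · rintro ((((⟨hne, c, hc, ⟨e, rfl⟩, e', rfl⟩ |
        ⟨_, _, ⟨hne, c, hc, ⟨e, rfl⟩, e', rfl⟩, rfl, rfl⟩) |
        ⟨_, _, ⟨hne, c, hc, ⟨e, rfl⟩, e', rfl⟩, rfl, rfl⟩) |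
        ⟨_, _, ⟨hne, c, hc, ⟨e, rfl⟩, e', rfl⟩, rfl, rfl⟩) |
        ⟨_, _, ⟨hne, c, hc, ⟨e, rfl⟩, e', rfl⟩, rfl, rfl⟩)
      · exact ⟨hne, c, ⟨0, by simp, c, hc, by simp⟩, ⟨e, rfl⟩, e', rfl⟩
      all_goals
        exact ⟨fun h => hne ((shift _).injective h), _, ⟨_, by simp, c, hc, rfl⟩,
          ⟨e, (shift_corner _ _ _).symm⟩, e', (shift_corner _ _ _).symm⟩
    · rintro ⟨hne, _, ⟨a, ha, c, hc, rfl⟩, ⟨e, rfl⟩, e', rfl⟩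
      have hne' : corner c e ≠ corner c e' := fun h => hne (by
        rw [← shift_corner, ← shift_corner, h])
      rcases ha with rfl | rfl | rfl | rfl | rfl
      · rw [zero_add]
        exact .inl (.inl (.inl (.inl ⟨hne', c, hc, ⟨e, rfl⟩, e', rfl⟩)))
      · exact .inl (.inl (.inl (.inr ⟨_, _, ⟨hne', c, hc, ⟨e, rfl⟩, e', rfl⟩,
          shift_corner _ _ _, shift_corner _ _ _⟩)))
      · exact .inl (.inl (.inr ⟨_, _, ⟨hne', c, hc, ⟨e, rfl⟩, e', rfl⟩,
          shift_corner _ _ _, shift_corner _ _ _⟩))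
      · exact .inl (.inr ⟨_, _, ⟨hne', c, hc, ⟨e, rfl⟩, e', rfl⟩,
          shift_corner _ _ _, shift_corner _ _ _⟩)
      · exact .inr ⟨_, _, ⟨hne', c, hc, ⟨e, rfl⟩, e', rfl⟩,
          shift_corner _ _ _, shift_corner _ _ _⟩

theorem exists_mem_cells {c : ℕ × ℕ} (hc : c ∈ allCells) : ∃ n, c ∈ cells n := by
  have h : ∀ m, m < 3 ^ m := fun m => Nat.lt_pow_self (by norm_num)
  refine ⟨c.1 + c.2, hc, ?_, ?_⟩ <;>
  · have := h (c.1 + c.2)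
    omega

theorem mem_allVertices {v : ℕ × ℕ} :
    v ∈ allVertices ↔ ∃ c ∈ allCells, ∃ e, corner c e = v := by
  simp only [allVertices, Set.mem_iUnion, mem_vertices]
  constructor
  · rintro ⟨n, c, hc, h⟩
    exact ⟨c, hc.1, h⟩
  · rintro ⟨c, hc, h⟩
    obtain ⟨n, hn⟩ := exists_mem_cells hc
    exact ⟨n, c, hn, h⟩

theorem infiniteGraph_adj {v w : ℕ × ℕ} : infiniteGraph.Adj v w ↔
    v ≠ w ∧ ∃ c ∈ allCells, (∃ e, corner c e = v) ∧ ∃ e, corner c e = w := by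
  simp only [infiniteGraph, SimpleGraph.iSup_adj, graph_adj]
  constructor
  · rintro ⟨n, hne, c, hc, h⟩
    exact ⟨hne, c, hc.1, h⟩
  · rintro ⟨hne, c, hc, h⟩
    obtain ⟨n, hn⟩ := exists_mem_cells hc
    exact ⟨n, hne, c, hn, h⟩

theorem corner_le (c : ℕ × ℕ) (e : Bool × Bool) :
    c.1 ≤ (corner c e).1 ∧ (corner c e).1 ≤ c.1 + 1 ∧
      c.2 ≤ (corner c e).2 ∧ (corner c e).2 ≤ c.2 + 1 := by
  have h : ∀ b : Bool, b.toNat ≤ 1 := Bool.toNat_le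
  have := h e.1
  have := h e.2
  simp only [corner]
  omega

/-- For coordinates at most `3 ^ n`, digit number `n` is 1 only at `3 ^ n` itself. So level `n` is
joined to the rest of the graph only at its sink. -/
theorem IsCell.pow_le_iff {n x y : ℕ} (h : IsCell x y) (hx : x ≤ 3 ^ n) (hy : y ≤ 3 ^ n) :
    x = 3 ^ n ↔ y = 3 ^ n := by
  have hp : 0 < 3 ^ n := by positivity
  have h1 : ∀ z, z ≤ 3 ^ n → (z / 3 ^ n % 3 = 1 ↔ z = 3 ^ n) := by
    intro z hz
    rcases hz.eq_or_lt with rfl | hz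
    · simp [Nat.div_self hp]
    · rw [Nat.div_eq_of_lt hz]
      simp [hz.ne]
  rw [← h1 x hx, ← h1 y hy]
  exact h n

/-- A cell that meets the `n`-level graph outside of the sink belongs to it. -/
theorem mem_cells_of_corner_mem_sites {n : ℕ} {c : ℕ × ℕ} (hc : c ∈ allCells) {e : Bool × Bool}
    (h : corner c e ∈ sites n) : c ∈ cells n := by
  obtain ⟨hv, hs⟩ := h
  obtain ⟨c', hc', e', he'⟩ := mem_vertices.1 hv
  have h1 := corner_le c' e'
  have h2 := corner_le c e
  rw [he'] at h1
  have h3 := hc'.2.1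
  have h4 := hc'.2.2
  have h5 := IsCell.pow_le_iff (n := n) hc (by omega) (by omega)
  by_cases h6 : c.1 = 3 ^ n
  · have h7 := h5.1 h6
    exact absurd (Prod.ext (by simp only [sink]; omega) (by simp only [sink]; omega)) hs
  · have h7 : c.2 ≠ 3 ^ n := fun h => h6 (h5.2 h)
    exact ⟨hc, by omega, by omega⟩

theorem mem_sites {n : ℕ} {v : ℕ × ℕ} :
    v ∈ sites n ↔ ∃ c ∈ cells n, ∃ i, cellSite c i = v := by
  constructor
  · intro hv
    obtain ⟨c', hc', e', he'⟩ := mem_vertices.1 hv.1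
    obtain ⟨c, hc, i, hi⟩ := exists_cellSite_eq hc'.1 e'
    refine ⟨c, mem_cells_of_corner_mem_sites hc (e := label i (dir c.1 c.2)) ?_, i, hi.trans he'⟩
    rw [cellSite] at hi
    rwa [hi, he']
  · rintro ⟨c, hc, i, rfl⟩
    refine ⟨mem_vertices.2 ⟨c, hc, _, rfl⟩, fun h => ?_⟩
    obtain ⟨h1, h2, h3⟩ := hc
    have h4 : (corner c (label i (dir c.1 c.2))) = (3 ^ n, 3 ^ n) := h
    have h5 : c.1 + (label i (dir c.1 c.2)).1.toNat = 3 ^ n := congrArg Prod.fst h4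
    have h6 : c.2 + (label i (dir c.1 c.2)).2.toNat = 3 ^ n := congrArg Prod.snd h4
    have hb : ∀ b : Bool, b.toNat ≤ 1 := Bool.toNat_le
    have hb1 := hb (label i (dir c.1 c.2)).1
    have hb2 := hb (label i (dir c.1 c.2)).2
    -- Within level `n` only the last diagonal cell has the sink as a corner, and its root is that
    -- corner.
    have hcc : c.1 = c.2 := by omega
    have hl : label i (dir c.1 c.2) = dir c.1 c.2 := by
      have hd : dir c.1 c.2 = (true, true) := by rw [← hcc, dir_self]
      rw [hd] at h5 h6 hb1 hb2 ⊢
      refine Prod.ext ?_ ?_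
      · by_contra hne
        simp only [Bool.not_eq_true] at hne
        rw [hne, Bool.toNat_false] at h5
        omega
      · by_contra hne
        simp only [Bool.not_eq_true] at hne
        rw [hne, Bool.toNat_false] at h6
        omega
    exact label_ne _ _ hl

theorem mem_allVertices_iff_cellSite {v : ℕ × ℕ} :
    v ∈ allVertices ↔ ∃ c ∈ allCells, ∃ i, cellSite c i = v := by
  rw [mem_allVertices]
  constructor
  · rintro ⟨c, hc, e, rfl⟩
    exact exists_cellSite_eq hc e
  · rintro ⟨c, hc, i, rfl⟩
    exact ⟨c, hc, _, rfl⟩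

theorem sites_finite (n : ℕ) : (sites n).Finite := by
  have : sites n ⊆ (fun p : (ℕ × ℕ) × Fin 3 => cellSite p.1 p.2) '' (cells n ×ˢ Set.univ) := by
    intro v hv
    obtain ⟨c, hc, i, rfl⟩ := mem_sites.1 hv
    exact ⟨(c, i), ⟨hc, trivial⟩, rfl⟩
  exact (((cells_finite n).prod Set.finite_univ).image _).subset this

instance (n : ℕ) : Finite (sites n) := sites_finite n

instance (n : ℕ) : Finite (cells n) := cells_finite n

theorem exists_mem_sites {v : ℕ × ℕ} (hv : v ∈ allVertices) : ∃ n, v ∈ sites n := by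
  obtain ⟨c, hc, i, rfl⟩ := mem_allVertices_iff_cellSite.1 hv
  obtain ⟨n, hn⟩ := exists_mem_cells hc
  exact ⟨n, mem_sites.2 ⟨c, hn, i, rfl⟩⟩

theorem cellRoot_mem {n : ℕ} {c : ℕ × ℕ} (hc : c ∈ cells n) :
    cellRoot c ∈ sites n ∨ cellRoot c = sink n := by
  by_cases h : cellRoot c = sink n
  · exact .inr h
  · exact .inl ⟨mem_vertices.2 ⟨c, hc, _, rfl⟩, h⟩

end Levels

/-! ### Cell structures of the Vicsek graphs and the diagonal -/

section Structures

open Sandpile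

variable {K W : Set (ℕ × ℕ)} {G : SimpleGraph (ℕ × ℕ)}

/-- The parametrization of the sites by cells and labels. -/
noncomputable def siteEquiv (hK : K ⊆ allCells)
    (hW : ∀ v, v ∈ W ↔ ∃ c ∈ K, ∃ i, cellSite c i = v) : K × Fin 3 ≃ W :=
  Equiv.ofBijective (fun p => ⟨cellSite p.1 p.2, (hW _).2 ⟨p.1, p.1.2, p.2, rfl⟩⟩) (by
    constructor
    · rintro ⟨c, i⟩ ⟨c', i'⟩ h
      obtain ⟨h1, h2⟩ := cellSite_injective (hK c.2) (hK c'.2) (congrArg Subtype.val h)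
      rw [Prod.mk.injEq]
      exact ⟨Subtype.ext h1, h2⟩
    · rintro ⟨v, hv⟩
      obtain ⟨c, hc, i, rfl⟩ := (hW v).1 hv
      exact ⟨(⟨c, hc⟩, i), rfl⟩)

theorem exists_corner_iff {c : ℕ × ℕ} {v : ℕ × ℕ} :
    (∃ e, corner c e = v) ↔ v = cellRoot c ∨ ∃ i, cellSite c i = v := by
  constructor
  · rintro ⟨e, rfl⟩
    by_cases h : e = dir c.1 c.2
    · exact .inl (by rw [h]; rfl)
    · obtain ⟨i, hi⟩ := exists_label _ _ h
      exact .inr ⟨i, by rw [cellSite, hi]⟩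
  · rintro (rfl | ⟨i, rfl⟩)
    · exact ⟨_, rfl⟩
    · exact ⟨_, rfl⟩

/-- The cell structure of a part of the Vicsek graph. -/
noncomputable def cellStructure (hK : K ⊆ allCells)
    (hW : ∀ v, v ∈ W ↔ ∃ c ∈ K, ∃ i, cellSite c i = v)
    (hG : ∀ v w, G.Adj v w ↔
      v ≠ w ∧ ∃ c ∈ K, (∃ e, corner c e = v) ∧ ∃ e, corner c e = w)
    (hfin : ∀ v : W, ∃ D : Set W, D.Finite ∧ v ∈ D ∧ ∀ x w : W,
      cellRoot ((siteEquiv hK hW).symm x).1 = (w : ℕ × ℕ) → w ∈ D → x ∈ D) :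
    CellStructure G W K where
  site := siteEquiv hK hW
  root c := cellRoot c
  height c := height (c : ℕ × ℕ).1 (c : ℕ × ℕ).2
  finite_closed := hfin
  height_lt c w h := by
    obtain ⟨⟨c', i⟩, rfl⟩ := (siteEquiv hK hW).surjective w
    rw [Equiv.symm_apply_apply]
    exact height_lt_of_cellSite_eq (hK c.2) (hK c'.2) h
  adj_iff v x := by
    obtain ⟨⟨c, i⟩, rfl⟩ := (siteEquiv hK hW).surjective v
    rw [Equiv.symm_apply_apply, hG]
    constructor
    · rintro ⟨hne, c', hc', hv, hx⟩
      rw [exists_corner_iff] at hv hx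
      rcases hv with hv | ⟨j, hv⟩
      · rcases hx with rfl | ⟨k, rfl⟩
        · exact absurd hv hne
        · refine .inr ⟨siteEquiv hK hW (⟨c', hc'⟩, k), rfl, fun h => hne ?_, .inr ?_⟩
          · rw [← h]
            rfl
          · rw [Equiv.symm_apply_apply]
            exact hv.symm
      · obtain ⟨rfl, rfl⟩ := cellSite_injective (hK hc') (hK c.2) hv
        rcases hx with rfl | ⟨k, rfl⟩
        · exact .inl rfl
        · refine .inr ⟨siteEquiv hK hW (c, k), rfl, fun h => hne ?_, .inl ?_⟩
          · rw [← h]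
            rfl
          · rw [Equiv.symm_apply_apply]
    · rintro (rfl | ⟨w, rfl, hne, h⟩)
      · refine ⟨fun h => ?_, c, c.2, ⟨_, rfl⟩, _, rfl⟩
        have := height_lt_of_cellSite_eq (hK c.2) (hK c.2) h
        omega
      · obtain ⟨⟨c', i'⟩, rfl⟩ := (siteEquiv hK hW).surjective w
        rw [Equiv.symm_apply_apply] at h
        refine ⟨fun h => hne (Subtype.ext h.symm), ?_⟩
        rcases h with h | h
        · simp only at h
          subst h
          exact ⟨c', c'.2, ⟨_, rfl⟩, _, rfl⟩
        · exact ⟨c', c'.2, ⟨_, h⟩, _, rfl⟩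

/-- The cell structure of the `n`-level Vicsek graph with its sink. -/
noncomputable def levelStructure (n : ℕ) : CellStructure (graph n) (sites n) (cells n) :=
  cellStructure (cells_subset_allCells n) (fun _ => mem_sites) (fun _ _ => graph_adj)
    fun _ => ⟨Set.univ, Set.toFinite _, trivial, fun _ _ _ _ => trivial⟩

/-- The cell structure of the infinite Vicsek graph. -/
noncomputable def infiniteStructure : CellStructure infiniteGraph allVertices allCells :=
  cellStructure subset_rfl (fun _ => mem_allVertices_iff_cellSite) (fun _ _ => infiniteGraph_adj)
    fun v => by
      obtain ⟨n, hn⟩ := exists_mem_sites v.2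
      -- A cell whose root is in `sites n` belongs to level `n`, so this finite set contains
      -- everything behind its elements.
      refine ⟨{w | (w : ℕ × ℕ) ∈ sites n}, ?_, hn, fun x w h hw => ?_⟩
      · exact (sites_finite n).preimage Subtype.val_injective.injOn
      · obtain ⟨⟨c, i⟩, rfl⟩ := (siteEquiv (W := allVertices) subset_rfl
          (fun _ => mem_allVertices_iff_cellSite)).surjective x
        rw [Equiv.symm_apply_apply] at h
        refine mem_sites.2 ⟨c, mem_cells_of_corner_mem_sites c.2 (e := dir (c : ℕ × ℕ).1
          (c : ℕ × ℕ).2) ?_, i, rfl⟩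
        change cellRoot c ∈ sites n
        rw [h]
        exact hw

/-- All cells at a vertex of `sites n` belong to level `n`. Therefore `load` commutes with
restriction to a level. -/
theorem deg_graph_eq {n : ℕ} {v : ℕ × ℕ} (hv : v ∈ sites n) :
    deg (graph n) v = deg infiniteGraph v := by
  unfold deg
  congr 1
  ext w
  rw [SimpleGraph.mem_neighborSet, SimpleGraph.mem_neighborSet, graph_adj, infiniteGraph_adj]
  refine and_congr_right fun _ => exists_congr fun c => ?_
  constructor
  · rintro ⟨hc, h⟩
    exact ⟨hc.1, h⟩
  · rintro ⟨hc, ⟨e, rfl⟩, h⟩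
    exact ⟨mem_cells_of_corner_mem_sites hc hv, ⟨e, rfl⟩, h⟩

theorem restrict_load (n : ℕ) (κ : allCells → Fin 3 → ℕ) :
    restrict (sites_subset_allVertices n) (infiniteStructure.load κ) =
      (levelStructure n).load fun c => κ (Set.inclusion (cells_subset_allCells n) c) := by
  funext v
  obtain ⟨⟨c, i⟩, rfl⟩ := (levelStructure n).site.surjective v
  have h : Set.inclusion (sites_subset_allVertices n) ((levelStructure n).site (c, i)) =
      infiniteStructure.site (Set.inclusion (cells_subset_allCells n) c, i) := rfl
  have h2 := deg_graph_eq ((levelStructure n).site (c, i)).2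
  simp only [restrict, CellStructure.load, CellStructure.cell, h, Equiv.symm_apply_apply]
  rw [h2]

theorem mem_recurrentSet {n : ℕ} {σ : sites n → ℕ} : σ ∈ recurrentSet n ↔
    ∃ κ : cells n → CellState, (levelStructure n).load (fun c => (κ c).val) = σ :=
  (levelStructure n).recurrent_iff σ

/-- The cells on the diagonal. -/
def diagonalCell (j : ℕ) : allCells := ⟨(j, j), isCell_self j⟩

theorem infiniteStructure_site_diagonal (j : ℕ) :
    (infiniteStructure.site (diagonalCell j, 0) : ℕ × ℕ) = (j, j) := by
  change cellSite (j, j) 0 = (j, j)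
  simp [cellSite, label, corner, dir_self]

theorem infiniteStructure_root_diagonal (j : ℕ) :
    infiniteStructure.root (diagonalCell j) = infiniteStructure.site (diagonalCell (j + 1), 0) := by
  rw [infiniteStructure_site_diagonal]
  change cellRoot (j, j) = (j + 1, j + 1)
  simp [cellRoot, corner, dir_self]

theorem site_diagonalCell_zero : infiniteStructure.site (diagonalCell 0, 0) = origin :=
  Subtype.ext (infiniteStructure_site_diagonal 0)

/-- Following roots inside level `n`, heights increase and are bounded, so the path arrives at the
sink, which is a diagonal vertex. -/
theorem exists_desc_diagonal (v : allVertices) :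
    ∃ j, infiniteStructure.Desc v (infiniteStructure.site (diagonalCell j, 0)) := by
  obtain ⟨n, hn⟩ := exists_mem_sites v.2
  obtain ⟨M, hM⟩ := ((cells_finite n).image fun c => height c.1 c.2).bddAbove
  obtain ⟨⟨c, i⟩, rfl⟩ := infiniteStructure.site.surjective v
  induction hk : M - height (c : ℕ × ℕ).1 (c : ℕ × ℕ).2 using Nat.strong_induction_on
    generalizing c i with
  | _ k ih =>
    have hc : (c : ℕ × ℕ) ∈ cells n := mem_cells_of_corner_mem_sites c.2 hn
    rcases cellRoot_mem hc with h | h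
    · obtain ⟨c', hc', i', h'⟩ := mem_sites.1 h
      have h1 := height_lt_of_cellSite_eq hc.1 hc'.1 h'
      have h2 := hM ⟨c', hc', rfl⟩
      obtain ⟨j, hj⟩ := ih _ (by dsimp only at h2 ⊢; omega) ⟨c', hc'.1⟩ i'
        (mem_sites.2 ⟨c', hc', i', rfl⟩) rfl
      refine ⟨j, hj.head ?_⟩
      rw [CellStructure.cell_site]
      exact h'.symm
    · refine ⟨3 ^ n, .single ?_⟩
      rw [CellStructure.cell_site, infiniteStructure_site_diagonal]
      exact h

end Structures

end Vicsek

namespace Sandpile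

open MeasureTheory ProbabilityTheory CellStructure

/-! ### The flow as an absorbed martingale -/

section FlowLaw

theorem CellStructure.flow_congr {s t : ℕ → CellState} {j : ℕ} (h : ∀ i < j, s i = t i) :
    flow s j = flow t j := by
  induction j with
  | zero => rfl
  | succ j ih => rw [flow, flow, ih fun i hi => h i (by omega), h j (by omega)]

/-- This is 16 times the transition matrix of the flow. Row `k` has mean `k`, and rows 1 to 3 keep
at most 10 of 16 on `{1,2,3}`. -/
theorem card_cellOut_eq : ∀ k m : Fin 5,
    (Finset.univ.filter fun s : CellState => cellOut k s.val = m).card =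
      ![![16, 0, 0, 0, 0], ![8, 3, 2, 3, 0], ![3, 3, 4, 3, 3], ![0, 3, 2, 3, 8],
        ![0, 0, 0, 0, 16]] k m := by
  decide +kernel

variable {Ω : Type*} [MeasurableSpace Ω] {P : Measure Ω} {Y : ℕ → Ω → CellState}

theorem measurable_flow (hm : ∀ j, Measurable (Y j)) (j : ℕ) :
    Measurable fun ω => flow (fun i => Y i ω) j := by
  induction j with
  | zero => exact measurable_const
  | succ j ih =>
    exact (measurable_of_countable fun p : ℕ × CellState => cellOut p.1 p.2.val).comp
      (ih.prodMk (hm j))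

theorem indepFun_flow (hm : ∀ j, Measurable (Y j)) (hi : iIndepFun Y P) (j : ℕ) :
    IndepFun (fun ω => flow (fun i => Y i ω) j) (Y j) P := by
  classical
  have h := hi.indepFun_finset (Finset.range j) {j} (by simp) hm
  -- An arbitrary default: the flow at `j` reads only states with index below `j`.
  let s0 : CellState := ⟨fun _ => 2, isCellRecurrent_two⟩
  have h1 := h.comp
    (measurable_of_countable fun r : Finset.range j → CellState =>
      flow (fun i => if hi : i ∈ Finset.range j then r ⟨i, hi⟩ else s0) j)
    (measurable_of_countable fun r : ({j} : Finset ℕ) → CellState =>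
      r ⟨j, Finset.mem_singleton_self j⟩)
  have h2 : (fun ω => flow (fun i => Y i ω) j) =
      (fun r : Finset.range j → CellState =>
        flow (fun i => if hi : i ∈ Finset.range j then r ⟨i, hi⟩ else s0) j) ∘
      fun ω i => Y i ω := by
    funext ω
    refine flow_congr fun i hi => ?_
    rw [dif_pos (Finset.mem_range.2 hi)]
  rw [h2]
  exact h1

theorem measureReal_flow_succ [IsProbabilityMeasure P] (hm : ∀ j, Measurable (Y j)) (hi : iIndepFun Y P)
    (hu : ∀ j (T : Finset CellState), P.real (Y j ⁻¹' T) = T.card / 16) (j : ℕ) (m : Fin 5) :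
    P.real {ω | flow (fun i => Y i ω) (j + 1) = m} =
      ∑ k : Fin 5, P.real {ω | flow (fun i => Y i ω) j = k} *
        (![![16, 0, 0, 0, 0], ![8, 3, 2, 3, 0], ![3, 3, 4, 3, 3], ![0, 3, 2, 3, 8],
          ![0, 0, 0, 0, 16]] k m : ℕ) / 16 := by
  classical
  let T : Fin 5 → Finset CellState := fun k => Finset.univ.filter fun s => cellOut k s.val = m
  have hset : {ω | flow (fun i => Y i ω) (j + 1) = m} =
      ⋃ k ∈ (Finset.univ : Finset (Fin 5)),
        ((fun ω => flow (fun i => Y i ω) j) ⁻¹' {(k : ℕ)} ∩ Y j ⁻¹' (T k)) := by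
    ext ω
    simp only [Set.mem_ofPred_eq, Finset.mem_univ, Set.iUnion_true, Set.mem_iUnion, Set.mem_inter_iff,
      Set.mem_preimage, Set.mem_singleton_iff, Finset.mem_coe, T, Finset.mem_filter, true_and]
    constructor
    · intro h
      have := flow_le (fun i => Y i ω) j
      exact ⟨⟨flow (fun i => Y i ω) j, by omega⟩, rfl, h⟩
    · rintro ⟨k, h1, h2⟩
      rw [flow, h1, h2]
  rw [hset, measureReal_biUnion_finset]
  · refine Finset.sum_congr rfl fun k _ => ?_
    have h1 := (indepFun_flow hm hi j).measure_inter_preimage_eq_mul {(k : ℕ)} (T k)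
      (.of_discrete) (.of_discrete)
    rw [measureReal_def, h1, ENNReal.toReal_mul, ← measureReal_def, ← measureReal_def, hu,
      card_cellOut_eq, mul_div_assoc]
    rfl
  · intro k _ k' _ hne
    rw [Function.onFun, Set.disjoint_left]
    rintro ω ⟨h1, -⟩ ⟨h2, -⟩
    exact hne (Fin.ext (h1.symm.trans h2))
  · intro k _
    exact (measurable_flow hm j .of_discrete).inter (hm j .of_discrete)

theorem measure_flow [IsProbabilityMeasure P] (hm : ∀ j, Measurable (Y j)) (hi : iIndepFun Y P)
    (hu : ∀ j (T : Finset CellState), P.real (Y j ⁻¹' T) = T.card / 16) :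
    P (⋃ j, {ω | flow (fun i => Y i ω) j = 0}) = 3 / 4 ∧
      P (⋃ j, {ω | flow (fun i => Y i ω) j = 4}) = 1 / 4 := by
  let a : Fin 5 → ℕ → ℝ := fun m j => P.real {ω | flow (fun i => Y i ω) j = (m : ℕ)}
  have hpos : ∀ m j, 0 ≤ a m j := fun m j => measureReal_nonneg
  have hrec : ∀ m j, a m (j + 1) = ∑ k : Fin 5, a k j *
        (![![16, 0, 0, 0, 0], ![8, 3, 2, 3, 0], ![3, 3, 4, 3, 3], ![0, 3, 2, 3, 8],
          ![0, 0, 0, 0, 16]] k m : ℕ) / 16 := fun m j => measureReal_flow_succ hm hi hu j m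
  have h0 : ∀ m : Fin 5, a m 0 = if m = 1 then 1 else 0 := by
    intro m
    simp only [a, flow]
    fin_cases m <;> simp
  have r0 := hrec 0
  have r1 := hrec 1
  have r2 := hrec 2
  have r3 := hrec 3
  have r4 := hrec 4
  simp [Fin.sum_univ_five] at r0 r1 r2 r3 r4
  -- Total mass, constant expectation, and geometric decay of the probability of not yet being
  -- absorbed.
  have key : ∀ j, a 0 j + a 1 j + a 2 j + a 3 j + a 4 j = 1 ∧
      a 1 j + 2 * a 2 j + 3 * a 3 j + 4 * a 4 j = 1 ∧
      a 1 j + a 2 j + a 3 j ≤ (10 / 16) ^ j := by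
    intro j
    induction j with
    | zero => simp [h0]
    | succ j ih =>
      obtain ⟨i1, i2, i3⟩ := ih
      have p1 := hpos 1 j
      have p3 := hpos 3 j
      refine ⟨?_, ?_, ?_⟩
      · rw [r0, r1, r2, r3, r4]
        linarith
      · rw [r1, r2, r3, r4]
        linarith
      · rw [pow_succ, r1, r2, r3]
        linarith
  have hz : Filter.Tendsto (fun j : ℕ => (10 / 16 : ℝ) ^ j) Filter.atTop (nhds 0) :=
    tendsto_pow_atTop_nhds_zero_of_lt_one (by norm_num) (by norm_num)
  have l4 : Filter.Tendsto (a 4) Filter.atTop (nhds (1 / 4)) := by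
    refine tendsto_of_tendsto_of_tendsto_of_le_of_le (g := fun j => 1 / 4 - (10 / 16 : ℝ) ^ j)
      (h := fun _ => 1 / 4) (by simpa only [sub_zero] using hz.const_sub (1 / 4)) tendsto_const_nhds ?_ ?_
    · intro j
      obtain ⟨i1, i2, i3⟩ := key j
      have p1 := hpos 1 j
      have p2 := hpos 2 j
      have p3 := hpos 3 j
      simp only
      linarith
    · intro j
      obtain ⟨i1, i2, i3⟩ := key j
      have p1 := hpos 1 j
      have p2 := hpos 2 j
      have p3 := hpos 3 j
      simp only
      linarith
  have l0 : Filter.Tendsto (a 0) Filter.atTop (nhds (3 / 4)) := by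
    refine tendsto_of_tendsto_of_tendsto_of_le_of_le (g := fun j => 3 / 4 - (10 / 16 : ℝ) ^ j)
      (h := fun _ => 3 / 4) (by simpa only [sub_zero] using hz.const_sub (3 / 4)) tendsto_const_nhds ?_ ?_
    · intro j
      obtain ⟨i1, i2, i3⟩ := key j
      have p1 := hpos 1 j
      have p2 := hpos 2 j
      have p3 := hpos 3 j
      simp only
      linarith
    · intro j
      obtain ⟨i1, i2, i3⟩ := key j
      have p1 := hpos 1 j
      have p2 := hpos 2 j
      have p3 := hpos 3 j
      simp only
      linarith
  have lim : ∀ (m : Fin 5) (x : ℝ), 0 ≤ x → Filter.Tendsto (a m) Filter.atTop (nhds x) →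
      Monotone (fun j => {ω | flow (fun i => Y i ω) j = (m : ℕ)}) →
      P (⋃ j, {ω | flow (fun i => Y i ω) j = (m : ℕ)}) = ENNReal.ofReal x := by
    intro m x hx hl hmono
    refine tendsto_nhds_unique (tendsto_measure_iUnion_atTop hmono) ?_
    have := (ENNReal.continuous_ofReal.tendsto x).comp hl
    refine this.congr fun j => ?_
    simp [a, measureReal_def]
  constructor
  · have := lim 0 (3 / 4) (by norm_num) l0 fun i j hij ω h => flow_eq_zero h hij
    rw [show (3 / 4 : ENNReal) = ENNReal.ofReal (3 / 4) by
      rw [ENNReal.ofReal_div_of_pos (by norm_num)]; norm_num]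
    exact this
  · have := lim 4 (1 / 4) (by norm_num) l4 fun i j hij ω h => flow_eq_four h hij
    rw [show (1 / 4 : ENNReal) = ENNReal.ofReal (1 / 4) by
      rw [ENNReal.ofReal_div_of_pos (by norm_num)]; norm_num]
    exact this

end FlowLaw

end Sandpile

namespace Vicsek

open Sandpile MeasureTheory ProbabilityTheory

/-! ### Measures with finite support -/

section Discrete

variable {α : Type*} [MeasurableSpace α] [MeasurableSingletonClass α] [Countable α]

/-- The common masses on `R` already sum to 1, so `ν'` has nothing left outside `R`. -/
theorem measure_ext_of_finite_support {ν ν' : Measure α} [IsProbabilityMeasure ν]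
    [IsProbabilityMeasure ν'] {R : Set α} (hR : R.Finite) (h1 : ν R = 1)
    (h : ∀ x ∈ R, ν' {x} = ν {x}) : ν' = ν := by
  have hsum : ∀ ρ : Measure α, ρ R = ∑ x ∈ hR.toFinset, ρ {x} := by
    intro ρ
    rw [sum_measure_singleton, Set.Finite.coe_toFinset]
  have h1' : ν' R = 1 := by
    rw [hsum, ← h1, hsum ν]
    exact Finset.sum_congr rfl fun x hx => h x (by simpa using hx)
  have hz : ∀ (ρ : Measure α) [IsProbabilityMeasure ρ], ρ R = 1 → ∀ x ∉ R, ρ {x} = 0 := by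
    intro ρ _ hρ x hx
    have h2 : ρ Rᶜ = 0 := (prob_compl_eq_zero_iff (hR.measurableSet)).2 hρ
    exact measure_mono_null (by simpa using hx) h2
  refine Measure.ext_of_singleton fun x => ?_
  by_cases hx : x ∈ R
  · exact h x hx
  · rw [hz ν h1 x hx, hz ν' h1' x hx]

theorem eq_uniformOn {ν : Measure α} [IsProbabilityMeasure ν] {R : Set α} (hR : R.Finite)
    (h1 : ν R = 1) {p : ENNReal} (h : ∀ x ∈ R, ν {x} = p) : ν = uniformOn R := by
  have hne : R.Nonempty := by
    rw [Set.nonempty_iff_ne_empty]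
    rintro rfl
    simp at h1
  have := isProbabilityMeasure_uniformOn hR hne
  have hsum : ∀ ρ : Measure α, ρ R = ∑ x ∈ hR.toFinset, ρ {x} := by
    intro ρ
    rw [sum_measure_singleton, Set.Finite.coe_toFinset]
  have hu : ∀ x ∈ R, uniformOn R {x} = (Measure.count R)⁻¹ := by
    intro x hx
    rw [uniformOn, cond_apply hR.measurableSet, Set.inter_singleton_of_mem hx,
      Measure.count_singleton, mul_one]
  refine measure_ext_of_finite_support hR (uniformOn_self hR hne) fun x hx => ?_
  rw [h x hx, hu x hx]
  rw [hsum, Finset.sum_congr rfl fun x hx => h x (by simpa using hx), Finset.sum_const,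
    nsmul_eq_mul] at h1
  rw [Measure.count_apply_finite R hR]
  exact ENNReal.eq_inv_of_mul_eq_one_left (by rwa [mul_comm])

end Discrete

/-! ### The infinite volume limit and its explosion probability -/

/-- Independent uniform recurrent states of the cells. -/
noncomputable def cellMeasure : Measure (allCells → CellState) :=
  Measure.infinitePi fun _ => uniformOn Set.univ

instance : Nonempty CellState := ⟨⟨fun _ => 2, isCellRecurrent_two⟩⟩

instance : IsProbabilityMeasure cellMeasure := by
  unfold cellMeasure
  infer_instance

/-- The sandpile with given states of the cells. -/
noncomputable def sandpile (κ : allCells → CellState) : allVertices → ℕ :=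
  infiniteStructure.load fun c => (κ c).val

theorem sandpile_measurable : Measurable sandpile := by
  refine measurable_pi_iff.2 fun v => ?_
  exact (measurable_of_countable fun s : CellState => s.val (infiniteStructure.site.symm v).2 +
    (deg infiniteGraph (v : ℕ × ℕ) - 3)).comp (measurable_pi_apply (infiniteStructure.cell v))

theorem sandpile_injective : Function.Injective sandpile := by
  intro κ κ' h
  funext c
  exact CellState.val_injective (congrFun (infiniteStructure.load_injective h) c)

/-- An injective measurable map between standard Borel spaces. It permits computing image measures
of sets not known to be measurable, such as the events of stabilizing and exploding. -/
theorem sandpile_measurableEmbedding : MeasurableEmbedding sandpile :=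
  sandpile_measurable.measurableEmbedding sandpile_injective

/-- The infinite volume limit. -/
noncomputable def limitMeasure : Measure (allVertices → ℕ) := cellMeasure.map sandpile

instance : IsProbabilityMeasure limitMeasure :=
  Measure.isProbabilityMeasure_map sandpile_measurable.aemeasurable

theorem restrict_measurable {A B : Set (ℕ × ℕ)} (h : A ⊆ B) :
    Measurable (restrict h : (B → ℕ) → A → ℕ) :=
  measurable_pi_iff.2 fun _ => measurable_pi_apply _

theorem uniformOn_univ_apply (T : Finset CellState) :
    uniformOn (Set.univ : Set CellState) T = T.card / 16 := by
  rw [uniformOn_univ, card_cellState, Measure.count_apply_finset]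
  norm_num

theorem recurrentSet_finite (n : ℕ) : (recurrentSet n).Finite := by
  refine (Set.finite_range fun κ : cells n → CellState =>
    (levelStructure n).load fun c => (κ c).val).subset fun σ hσ => ?_
  exact mem_recurrentSet.1 hσ

theorem restrict_sandpile_mem (n : ℕ) (κ : allCells → CellState) :
    restrict (sites_subset_allVertices n) (sandpile κ) ∈ recurrentSet n := by
  rw [sandpile, restrict_load]
  exact mem_recurrentSet.2 ⟨fun c => κ (Set.inclusion (cells_subset_allCells n) c), rfl⟩

/-- Prescribing a recurrent sandpile on level `n` prescribes the states of exactly the cells of that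
level, which has the same probability, a power of 1/16, for all of them. -/
theorem map_restrict_limitMeasure (n : ℕ) :
    limitMeasure.map (restrict (sites_subset_allVertices n)) = uniformMeasure n := by
  classical
  have hr := restrict_measurable (sites_subset_allVertices n)
  have : IsProbabilityMeasure (limitMeasure.map (restrict (sites_subset_allVertices n))) :=
    Measure.isProbabilityMeasure_map hr.aemeasurable
  have hmap : ∀ A : Set (sites n → ℕ), limitMeasure.map (restrict (sites_subset_allVertices n)) A =
      cellMeasure {κ | restrict (sites_subset_allVertices n) (sandpile κ) ∈ A} := by
    intro A
    rw [Measure.map_apply hr .of_discrete, limitMeasure, Measure.map_apply sandpile_measurable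
      (hr .of_discrete)]
    rfl
  let I : Finset allCells := ((cells_finite n).preimage Subtype.val_injective.injOn).toFinset
  have hI : ∀ c : allCells, c ∈ I ↔ (c : ℕ × ℕ) ∈ cells n := fun c => by simp [I]
  refine eq_uniformOn (p := ∏ c ∈ I, (1 / 16)) (recurrentSet_finite n) ?_ fun σ hσ => ?_
  · rw [hmap]
    convert measure_univ (μ := cellMeasure)
    exact Set.eq_univ_of_forall fun κ => restrict_sandpile_mem n κ
  · obtain ⟨κ, rfl⟩ := mem_recurrentSet.1 hσ
    let T : allCells → Finset CellState := fun c =>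
      if h : (c : ℕ × ℕ) ∈ cells n then {κ ⟨c, h⟩} else ∅
    have hset : {κ' | restrict (sites_subset_allVertices n) (sandpile κ') ∈
        ({(levelStructure n).load fun c => (κ c).val} : Set (sites n → ℕ))} =
        Set.pi I fun c => (T c : Set CellState) := by
      ext κ'
      rw [Set.mem_ofPred_eq, Set.mem_singleton_iff, sandpile, restrict_load,
        (levelStructure n).load_injective.eq_iff, Set.mem_pi]
      constructor
      · intro h c hc
        have hc' := (hI c).1 hc
        have h2 := CellState.val_injective (congrFun h ⟨c, hc'⟩)
        simp only [T, dif_pos hc', Finset.coe_singleton, Set.mem_singleton_iff]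
        exact h2
      · intro h
        funext c
        have h2 := h (Set.inclusion (cells_subset_allCells n) c) ((hI _).2 c.2)
        simp only [T, Subtype.coe_prop, dif_pos, Finset.coe_singleton,
          Set.mem_singleton_iff] at h2
        rw [h2]
    rw [hmap, hset, cellMeasure, Measure.infinitePi_pi _ fun _ _ => .of_discrete]
    refine Finset.prod_congr rfl fun c hc => ?_
    rw [uniformOn_univ_apply]
    simp [T, dif_pos ((hI c).1 hc)]

/-- The limit over `k` is attained for every `k ≥ n`. -/
theorem uniformMeasure_restrict_eq {n k : ℕ} (h : n ≤ k) (σ : sites n → ℕ) :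
    uniformMeasure k {η | restrict (sites_subset_sites h) η = σ} =
      limitMeasure {η | restrict (sites_subset_allVertices n) η = σ} := by
  rw [← map_restrict_limitMeasure, Measure.map_apply
    (restrict_measurable (sites_subset_allVertices k)) .of_discrete]
  rfl

theorem isInfiniteVolumeLimit_limitMeasure : IsInfiniteVolumeLimit limitMeasure where
  isProbabilityMeasure := inferInstance
  weakLimit ε hε n σ _ := ⟨0, fun k hn _ => by
    rw [measureReal_def, measureReal_def, uniformMeasure_restrict_eq hn, sub_self, abs_zero]
    exact hε⟩

/-- Convergence is given for recurrent `σ` only, but these carry the full mass of the limit, so all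
marginals on `sites n` agree. Every finite set of vertices lies in some `sites n`, hence the
measures agree. -/
theorem IsInfiniteVolumeLimit.eq_limitMeasure {μ : Measure (allVertices → ℕ)}
    (hμ : IsInfiniteVolumeLimit μ) : μ = limitMeasure := by
  have := hμ.isProbabilityMeasure
  have hn : ∀ n, μ.map (restrict (sites_subset_allVertices n)) =
      limitMeasure.map (restrict (sites_subset_allVertices n)) := by
    intro n
    have hr := restrict_measurable (sites_subset_allVertices n)
    have h1 : IsProbabilityMeasure (μ.map (restrict (sites_subset_allVertices n))) :=
      Measure.isProbabilityMeasure_map hr.aemeasurable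
    have h2 : IsProbabilityMeasure (limitMeasure.map (restrict (sites_subset_allVertices n))) :=
      Measure.isProbabilityMeasure_map hr.aemeasurable
    refine measure_ext_of_finite_support (recurrentSet_finite n) ?_ fun σ hσ => ?_
    · rw [Measure.map_apply hr .of_discrete, limitMeasure,
        Measure.map_apply sandpile_measurable (hr .of_discrete)]
      convert measure_univ (μ := cellMeasure)
      exact Set.eq_univ_of_forall fun κ => restrict_sandpile_mem n κ
    · rw [Measure.map_apply hr (measurableSet_singleton σ),
        Measure.map_apply hr (measurableSet_singleton σ)]
      have hreal : limitMeasure.real {η | restrict (sites_subset_allVertices n) η = σ} =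
          μ.real {η | restrict (sites_subset_allVertices n) η = σ} := by
        refine eq_of_abs_sub_le_all fun ε hε => ?_
        obtain ⟨N, hN⟩ := hμ.weakLimit ε hε n σ hσ
        have := hN (max n N) (le_max_left _ _) (le_max_right _ _)
        rw [measureReal_def, uniformMeasure_restrict_eq (le_max_left n N)] at this
        exact this.le
      exact ((measureReal_eq_measureReal_iff).1 hreal).symm
  have hproj : ∀ ρ : Measure (allVertices → ℕ),
      (∀ n, ρ.map (restrict (sites_subset_allVertices n)) =
        limitMeasure.map (restrict (sites_subset_allVertices n))) →
      IsProjectiveLimit ρ fun J => limitMeasure.map J.restrict := by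
    intro ρ hρ J
    obtain ⟨n, hJ⟩ : ∃ n, ∀ v ∈ J, (v : ℕ × ℕ) ∈ sites n := by
      choose f hf using fun v : allVertices => exists_mem_sites v.2
      exact ⟨J.sup f, fun v hv => sites_subset_sites (Finset.le_sup hv) (hf v)⟩
    let g : (sites n → ℕ) → (J → ℕ) := fun η v => η ⟨v, hJ v v.2⟩
    have hg : Measurable g := measurable_pi_iff.2 fun _ => measurable_pi_apply _
    have hr := restrict_measurable (sites_subset_allVertices n)
    have hc : ∀ ρ' : Measure (allVertices → ℕ), ρ'.map J.restrict =
        (ρ'.map (restrict (sites_subset_allVertices n))).map g := by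
      intro ρ'
      rw [Measure.map_map hg hr]
      rfl
    rw [hc, hρ, ← hc]
  exact (hproj μ hn).unique (hproj limitMeasure fun _ => rfl)

theorem addParticle_sandpile (κ : allCells → CellState) : addParticle (sandpile κ) origin =
    infiniteStructure.load (fun c => (κ c).val) +
      particles [infiniteStructure.site (diagonalCell 0, 0)] := by
  classical
  rw [particles_cons, particles_nil, add_zero, site_diagonalCell_zero]
  unfold addParticle sandpile
  congr

theorem diagonalCell_injective : Function.Injective diagonalCell := fun _ _ h =>
  congrArg (fun c : allCells => (c : ℕ × ℕ).1) h

theorem cellMeasure_flow :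
    cellMeasure (⋃ j, {κ | CellStructure.flow (fun i => κ (diagonalCell i)) j = 0}) = 3 / 4 ∧
      cellMeasure (⋃ j, {κ | CellStructure.flow (fun i => κ (diagonalCell i)) j = 4}) = 1 / 4 := by
  refine measure_flow (Y := fun j (κ : allCells → CellState) => κ (diagonalCell j)) (fun j => measurable_pi_apply _) ?_ ?_
  · exact (iIndepFun_infinitePi (P := fun _ : allCells => uniformOn (Set.univ : Set CellState))
      (X := fun _ s => s) fun _ => measurable_id).precomp diagonalCell_injective
  · intro j T
    have h := Measure.infinitePi_pi (fun _ : allCells => uniformOn (Set.univ : Set CellState))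
      (s := {diagonalCell j}) (t := fun _ => (T : Set CellState)) fun _ _ => .of_discrete
    rw [Finset.prod_singleton, uniformOn_univ_apply] at h
    have hs : (fun κ : allCells → CellState => κ (diagonalCell j)) ⁻¹' T =
        Set.pi (({diagonalCell j} : Finset allCells) : Set allCells) fun _ => (T : Set CellState) := by
      ext κ
      simp
    rw [hs, measureReal_def, cellMeasure, h]
    simp

/-- The flow events `A` and `B` have total mass 1 and lie in the two disjoint events in question.
Sandwiching between `A` and `Bᶜ`, or `B` and `Aᶜ`, avoids measurability of the latter. -/
theorem limitMeasure_stabilizes_explodes :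
    limitMeasure {η | Stabilizes infiniteGraph (addParticle η origin)} = 3 / 4 ∧
      limitMeasure {η | Explodes infiniteGraph (addParticle η origin)} = 1 / 4 := by
  obtain ⟨h0, h4⟩ := cellMeasure_flow
  rw [limitMeasure, sandpile_measurableEmbedding.map_apply, sandpile_measurableEmbedding.map_apply]
  set A := ⋃ j, {κ : allCells → CellState |
    CellStructure.flow (fun i => κ (diagonalCell i)) j = 0} with hA
  set B := ⋃ j, {κ : allCells → CellState |
    CellStructure.flow (fun i => κ (diagonalCell i)) j = 4} with hB
  have hmeas : ∀ m, MeasurableSet (⋃ j, {κ : allCells → CellState |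
      CellStructure.flow (fun i => κ (diagonalCell i)) j = m}) := fun m =>
    .iUnion fun j => measurable_flow (Y := fun j (κ : allCells → CellState) => κ (diagonalCell j))
      (fun j => measurable_pi_apply _) j (measurableSet_singleton m)
  have hAS : A ⊆ sandpile ⁻¹' {η | Stabilizes infiniteGraph (addParticle η origin)} := by
    intro κ hκ
    obtain ⟨j, hj⟩ := Set.mem_iUnion.1 hκ
    rw [Set.mem_preimage, Set.mem_ofPred_eq, addParticle_sandpile]
    exact infiniteStructure.stabilizes_of_flow_eq_zero infiniteStructure_root_diagonal κ hj
  have hBE : B ⊆ sandpile ⁻¹' {η | Explodes infiniteGraph (addParticle η origin)} := by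
    intro κ hκ
    obtain ⟨j, hj⟩ := Set.mem_iUnion.1 hκ
    rw [Set.mem_preimage, Set.mem_ofPred_eq, addParticle_sandpile]
    exact infiniteStructure.explodes_of_flow_eq_four infiniteStructure_root_diagonal κ
      exists_desc_diagonal hj
  have hdisj : ∀ κ, κ ∈ sandpile ⁻¹' {η | Stabilizes infiniteGraph (addParticle η origin)} →
      κ ∉ sandpile ⁻¹' {η | Explodes infiniteGraph (addParticle η origin)} := by
    intro κ h
    have : Nonempty allVertices := ⟨origin⟩
    exact Stabilizes.not_explodes h
  constructor
  · refine le_antisymm ?_ (h0 ▸ measure_mono hAS)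
    refine (measure_mono (t := Bᶜ) fun κ hκ hκB => hdisj κ hκ (hBE hκB)).trans_eq ?_
    rw [prob_compl_eq_one_sub (hmeas 4), h4]
    refine ENNReal.sub_eq_of_eq_add (h4 ▸ measure_ne_top _ _) ?_
    rw [ENNReal.div_add_div_same]
    norm_num
    exact (ENNReal.div_self (by norm_num) (by norm_num)).symm
  · refine le_antisymm ?_ (h4 ▸ measure_mono hBE)
    refine (measure_mono (t := Aᶜ) fun κ hκ hκA => hdisj κ (hAS hκA) hκ).trans_eq ?_
    rw [prob_compl_eq_one_sub (hmeas 0), h0]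
    refine ENNReal.sub_eq_of_eq_add (h0 ▸ measure_ne_top _ _) ?_
    rw [ENNReal.div_add_div_same]
    norm_num
    exact (ENNReal.div_self (by norm_num) (by norm_num)).symm

end Vicsek

theorem theorem1 :
    (∃! μ : MeasureTheory.Measure (Vicsek.allVertices → ℕ), Vicsek.IsInfiniteVolumeLimit μ) ∧
    ∀ μ : MeasureTheory.Measure (Vicsek.allVertices → ℕ), Vicsek.IsInfiniteVolumeLimit μ →
      μ {η | Sandpile.Stabilizes Vicsek.infiniteGraph
          (Sandpile.addParticle η Vicsek.origin)} = 3 / 4 ∧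
      μ {η | Sandpile.Explodes Vicsek.infiniteGraph
          (Sandpile.addParticle η Vicsek.origin)} = 1 / 4 := by
  refine ⟨⟨Vicsek.limitMeasure, Vicsek.isInfiniteVolumeLimit_limitMeasure,
    fun μ hμ => hμ.eq_limitMeasure⟩, fun μ hμ => ?_⟩
  rw [hμ.eq_limitMeasure]
  exact Vicsek.limitMeasure_stabilizes_explodes
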